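/- Let $X$ be a Euclidean space (a finite-dimensional real inner product space) with closed unit ball $B$, and let $f\colon X\to\mathbb R$ be locally Lipschitz. The Clarke subdifferential $\partial f(x)$ is the closed convex hull of all limits $\lim_r\nabla f(x_r)$ along sequences $x_r\to x$ of points at which $f$ is differentiable. For $\varepsilon\ge 0$ put $\partial_\varepsilon f(x)=\operatorname{conv}\,\partial f(x+\varepsilon B)$, and let the Goldstein subgradient $g_\varepsilon(x)$ be the shortest vector in $\partial_\varepsilon f(x)$. Let $M\subset X$ be a $C^2$-smooth manifold around a point $\bar x\in M$: near $\bar x$, $M$ is the zero set of a $C^2$ map into some $\mathbb R^m$ with surjective derivative at $\bar x$. Let $d_M$ be the distance to $M$, and for $x$ near $\bar x$ let $P_M(x)$ be the nearest point to $x$ in $M$. Assume that $f$ grows robustly relative to $M$ at $\bar x$, that is: * (quadratic growth) for some $\delta>0$, $f(x)-f(\bar x)\ge\frac{\delta}{2}|x-\bar x|^2$ for all $x$ near $\bar x$; * $f$ is subdifferentially regular at every $x\in M$: for all $y\in X$, $\lim_{t\downarrow0}\frac1t\big(f(x+ty)-f(x)\big)=\max_{v\in\partial f(x)}\langle v,y\rangle$;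 * the restriction $f|_M$ is $C^2$-smooth (around $\bar x$); * (upper Lipschitz) for some $K>0$, $\partial f(y)\subset\partial f(x)+K|x-y|B$ for all $x\in M$ and $y\in X$ near $\bar x$; * (aiming condition) for some $\mu>0$, $\langle v,x-P_M(x)\rangle\ge\mu\, d_M(x)$ for all $x$ near $\bar x$ and all $v\in\partial f(x)$. Assume also that $f$ has tempered growth at $\bar x$ relative to $M$: for every angle $\theta>0$ and every sufficiently small $\beta>0$, for all sequences $\bar x\ne x_r\to\bar x$ and $0\le\varepsilon_r\le\beta|x_r-\bar x|$ with $g_{\varepsilon_r}(x_r)\to0$, the vectors $g_{\varepsilon_r}(x_r)$ and the Riemannian gradients $\nabla_M f(P_M(x_r))$ are eventually nonzero and subtend an angle less than $\theta$. Let $L>0$ (for example, a Lipschitz constant of $f$) and $\beta>0$, and consider the following algorithm. At the current point $x$, start with $\varepsilon=\frac12L$ and, while $|g_\varepsilon(x)|\le\varepsilon$, replace $\varepsilon$ by $\frac12\varepsilon$. Then replace $\varepsilon$ by $\beta\varepsilon$, set $g=g_\varepsilon(x)$, and replace $x$ by $x-\varepsilon\frac{g}{|g|}$. Repeat. If an iteration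 cannot be completed (the while loop does not terminate, or $g=0$), then the current point stays unchanged from then on. Then there is $\beta_0>0$ such that for every $\beta\in(0,\beta_0]$ there is $\rho>0$ such that, for every initial point $x_0$ with $|x_0-\bar x|<\rho$, the points $x_k$ generated by the algorithm have the following properties: whenever $x_k\ne\bar x$, the next iteration can be completed (the while loop terminates and $g\ne0$); and $x_k\to\bar x$ nearly linearly, in the sense that there exist constants $a,b>0$ with $$|x_k-\bar x|\le a\,e^{-b\sqrt k}\qquad\text{for all }k=0,1,2,\dots$$ -/

import Mathlib

open Filter Topology Metric

namespace Goldstein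

noncomputable section

/-! `X` is a Euclidean space, that is, a finite-dimensional real inner product space. -/

section Basic

variable {X : Type*} [NormedAddCommGroup X] [InnerProductSpace ℝ X] [FiniteDimensional ℝ X]

/-- The Clarke subdifferential `∂f(x)`: the closed convex hull of all limits of gradients of `f`
along sequences of points of differentiability converging to `x`. -/
def clarkeSubdiff (f : X → ℝ) (x : X) : Set X :=
  closure (convexHull ℝ {v : X | ∃ u : ℕ → X, (∀ n, DifferentiableAt ℝ f (u n)) ∧
    Tendsto u atTop (𝓝 x) ∧ Tendsto (fun n => gradient f (u n)) atTop (𝓝 v)})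

/-- The Goldstein subdifferential `∂_ε f(x) = conv (∂f (x + ε B))`, with `B` the closed unit
ball. -/
def goldsteinSubdiff (f : X → ℝ) (ε : ℝ) (x : X) : Set X :=
  convexHull ℝ (⋃ y ∈ closedBall x ε, clarkeSubdiff f y)

open Classical in
/-- A shortest vector of the set `S`, when there is one (it is then unique for convex `S`);
the value is `0` by convention if there is none. -/
def shortest (S : Set X) : X :=
  if h : ∃ g ∈ S, ∀ v ∈ S, ‖g‖ ≤ ‖v‖ then h.choose else 0

/-- The Goldstein subgradient `g_ε(x)`: the shortest vector in `∂_ε f(x)`.  For locally Lipschitz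
`f` and `ε ≥ 0` the set `∂_ε f(x)` is nonempty, compact and convex. -/
def goldsteinSubgrad (f : X → ℝ) (ε : ℝ) (x : X) : X :=
  shortest (goldsteinSubdiff f ε x)

/-- The function `f` grows quadratically at `xbar`. -/
def GrowsQuadratically (f : X → ℝ) (xbar : X) : Prop :=
  ∃ δ : ℝ, 0 < δ ∧ ∀ᶠ x in 𝓝 xbar, δ / 2 * ‖x - xbar‖ ^ 2 ≤ f x - f xbar

/-- The Clarke directional derivative `f°(x; y) = max {⟨v, y⟩ : v ∈ ∂f(x)}`. -/
def clarkeDirDeriv (f : X → ℝ) (x y : X) : ℝ :=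
  sSup ((fun v : X => inner ℝ v y) '' clarkeSubdiff f x)

/-- Subdifferential regularity of `f` at `x`: in every direction the classical one-sided
directional derivative exists and equals the Clarke directional derivative. -/
def SubdiffRegularAt (f : X → ℝ) (x : X) : Prop :=
  ∀ y : X, Tendsto (fun t : ℝ => (1 / t) * (f (x + t • y) - f x)) (𝓝[>] (0 : ℝ))
    (𝓝 (clarkeDirDeriv f x y))

/-- Nearly linear convergence of a sequence to `xbar`:
`‖x_r - xbar‖ ≤ a * exp (-b * √r)` for all `r`, with constants `a, b > 0`. -/
def ConvergesNearlyLinearly (x : ℕ → X) (xbar : X) : Prop :=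
  ∃ a b : ℝ, 0 < a ∧ 0 < b ∧ ∀ r : ℕ, ‖x r - xbar‖ ≤ a * Real.exp (-b * √(r : ℝ))

end Basic

section Manifold

variable {X : Type*} [NormedAddCommGroup X] [InnerProductSpace ℝ X] [FiniteDimensional ℝ X]

/-- The set `M` is a `C²`-smooth manifold around its point `xbar`: near `xbar` it is the zero set
of a `C²` map into some `ℝ^m` with surjective derivative at `xbar`. -/
def IsC2ManifoldAround (M : Set X) (xbar : X) : Prop :=
  xbar ∈ M ∧ ∃ (m : ℕ) (F : X → EuclideanSpace ℝ (Fin m)) (U : Set X),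
    IsOpen U ∧ xbar ∈ U ∧ ContDiffOn ℝ 2 F U ∧ Function.Surjective (fderiv ℝ F xbar) ∧
      M ∩ U = {x ∈ U | F x = 0}

open Classical in
/-- A nearest point to `x` in `M`, when there is one (near a point around which `M` is a `C²`
manifold, it exists and is unique); by convention `x` itself if there is none. -/
def nearestPoint (M : Set X) (x : X) : X :=
  if h : ∃ p ∈ M, ∀ q ∈ M, ‖x - p‖ ≤ ‖x - q‖ then h.choose else x

/-- The restriction of `f` to `M` is `C²`-smooth around `xbar`: near `xbar`, it agrees on `M` with
a function that is `C²` on a neighbourhood of `xbar` in the ambient space. -/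
def RestrictionC2At (f : X → ℝ) (M : Set X) (xbar : X) : Prop :=
  ∃ h : X → ℝ, ContDiffAt ℝ 2 h xbar ∧ ∀ᶠ x in 𝓝[M] xbar, h x = f x

/-- The tangent space to `M` at `p`: the linear span of the tangent cone (which is already a
subspace when `M` is a manifold around `p`). -/
def tangentSpaceAt (M : Set X) (p : X) : Submodule ℝ X :=
  Submodule.span ℝ (tangentConeAt ℝ M p)

/-- The Riemannian gradient `∇_M f(p)`: the orthogonal projection onto the tangent space to `M`
at `p` of a gradient of `f` within `M` at `p`.  It does not depend on the choice of the latter;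
see `riemannianGrad_eq`. -/
def riemannianGrad (f : X → ℝ) (M : Set X) (p : X) : X :=
  (tangentSpaceAt M p).starProjection (gradientWithin f M p)

/-- If `f` agrees on `M` near `p` with a function `h` differentiable at `p`, then its Riemannian
gradient is the orthogonal projection of `∇h(p)` onto the tangent space. -/
theorem riemannianGrad_eq {f h : X → ℝ} {M : Set X} {p : X} (hp : p ∈ M)
    (hh : DifferentiableAt ℝ h p) (hfh : ∀ᶠ x in 𝓝[M] p, h x = f x) :
    riemannianGrad f M p = (tangentSpaceAt M p).starProjection (gradient h p) := by
  have h1 : HasFDerivWithinAt h (fderiv ℝ h p) M p := hh.hasFDerivAt.hasFDerivWithinAt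
  have hfh' : f =ᶠ[𝓝[M] p] h := hfh.mono fun _ hx => hx.symm
  have h2 : HasFDerivWithinAt f (fderiv ℝ h p) M p :=
    h1.congr_of_eventuallyEq hfh' (hfh'.self_of_nhdsWithin hp)
  have h3 : HasFDerivWithinAt f (fderivWithin ℝ f M p) M p :=
    h2.differentiableWithinAt.hasFDerivWithinAt
  have h4 := h3.unique_on h2
  have key : ∀ v ∈ tangentSpaceAt M p,
      inner ℝ v (gradientWithin f M p - gradient h p) = 0 := by
    intro v hv
    refine Submodule.span_induction ?_ ?_ ?_ ?_ hv
    · intro x hx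
      rw [inner_sub_right, real_inner_comm, real_inner_comm (gradient h p) x,
        gradientWithin, gradient, InnerProductSpace.toDual_symm_apply,
        InnerProductSpace.toDual_symm_apply, h4 hx, sub_self]
    · simp
    · intro x y _ _ hx hy
      rw [inner_add_left, hx, hy, add_zero]
    · intro a x _ hx
      rw [real_inner_smul_left, hx, mul_zero]
  have h5 : (tangentSpaceAt M p).starProjection (gradientWithin f M p - gradient h p) = 0 := by
    rw [Submodule.starProjection_apply_eq_zero_iff]
    exact (Submodule.mem_orthogonal _ _).2 key
  rw [map_sub, sub_eq_zero] at h5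
  exact h5

/-- The subdifferential `∂f` is upper Lipschitz relative to `M` at `xbar`: for some `K > 0`,
`∂f(y) ⊆ ∂f(x) + K ‖x - y‖ B` for all `x ∈ M` and all `y` near `xbar`. -/
def UpperLipschitz (f : X → ℝ) (M : Set X) (xbar : X) : Prop :=
  ∃ K : ℝ, 0 < K ∧ ∃ ρ : ℝ, 0 < ρ ∧ ∀ x ∈ M ∩ ball xbar ρ, ∀ y ∈ ball xbar ρ,
    ∀ v ∈ clarkeSubdiff f y, ∃ w ∈ clarkeSubdiff f x, ‖v - w‖ ≤ K * ‖x - y‖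

/-- The aiming condition for `f` relative to `M` at `xbar`. -/
def AimingCondition (f : X → ℝ) (M : Set X) (xbar : X) : Prop :=
  ∃ μ : ℝ, 0 < μ ∧ ∀ᶠ x in 𝓝 xbar, ∀ v ∈ clarkeSubdiff f x,
    μ * infDist x M ≤ inner ℝ v (x - nearestPoint M x)

/-- Robust growth of `f` relative to `M` at `xbar`. -/
structure GrowsRobustly (f : X → ℝ) (M : Set X) (xbar : X) : Prop where
  quadratic : GrowsQuadratically f xbar
  regular : ∀ x ∈ M, SubdiffRegularAt f x
  smooth : RestrictionC2At f M xbar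
  upperLipschitz : UpperLipschitz f M xbar
  aiming : AimingCondition f M xbar

/-- Tempered growth of `f` relative to `M` at `xbar`: given any angle `θ > 0`, for every
sufficiently small `β > 0`, whenever points `xbar ≠ x_r → xbar` and radii
`0 ≤ ε_r ≤ β ‖x_r - xbar‖` have Goldstein subgradients `g_{ε_r}(x_r) → 0`, these subgradients and
the Riemannian gradients `∇_M f(P_M(x_r))` are eventually nonzero and subtend an angle less
than `θ`. -/
def TemperedGrowth (f : X → ℝ) (M : Set X) (xbar : X) : Prop :=
  ∀ θ : ℝ, 0 < θ → ∃ β₀ : ℝ, 0 < β₀ ∧ ∀ β : ℝ, 0 < β → β ≤ β₀ →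
    ∀ (x : ℕ → X) (ε : ℕ → ℝ), (∀ r, x r ≠ xbar) → Tendsto x atTop (𝓝 xbar) →
      (∀ r, 0 ≤ ε r ∧ ε r ≤ β * ‖x r - xbar‖) →
      Tendsto (fun r => goldsteinSubgrad f (ε r) (x r)) atTop (𝓝 0) →
      ∀ᶠ r in atTop, goldsteinSubgrad f (ε r) (x r) ≠ 0 ∧
        riemannianGrad f M (nearestPoint M (x r)) ≠ 0 ∧
        InnerProductGeometry.angle (goldsteinSubgrad f (ε r) (x r))
          (riemannianGrad f M (nearestPoint M (x r))) < θ

end Manifold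

section Algorithm

variable {X : Type*} [NormedAddCommGroup X] [InnerProductSpace ℝ X] [FiniteDimensional ℝ X]

open Classical in
/-- The bisection loop at `x`: start from `ε = L / 2` and replace `ε` by `ε / 2` as long as
`‖g_ε(x)‖ ≤ ε`.  So it returns the first `ε` among `L / 2, L / 4, L / 8, …` with
`ε < ‖g_ε(x)‖`; the value `none` means that the loop runs forever. -/
def bisection (f : X → ℝ) (L : ℝ) (x : X) : Option ℝ :=
  if h : ∃ n : ℕ, L / 2 ^ (n + 1) < ‖goldsteinSubgrad f (L / 2 ^ (n + 1)) x‖ then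
    some (L / 2 ^ (Nat.find h + 1))
  else none

open Classical in
/-- One iteration of the algorithm at `x`: estimate the Goldstein modulus by bisection, scale the
estimate by `β`, and take a Goldstein step with the resulting radius.  The value `none` means that
the iteration cannot be completed: the bisection loop runs forever, or `g = 0` in the step. -/
def fastStep (f : X → ℝ) (L β : ℝ) (x : X) : Option X :=
  (bisection f L x).bind fun ε =>
    let g := goldsteinSubgrad f (β * ε) x
    if g = 0 then none else some (x - ((β * ε) / ‖g‖) • g)

/-- The current point of the algorithm after `k` iterations from `x₀`; it stays unchanged from the
moment when an iteration cannot be completed. -/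
def fastIterate (f : X → ℝ) (L β : ℝ) (x₀ : X) : ℕ → X
  | 0 => x₀
  | k + 1 => (fastStep f L β (fastIterate f L β x₀ k)).getD (fastIterate f L β x₀ k)

end Algorithm

end

end Goldstein

open Goldstein

/-!
Write `D` for the distance of an iterate `x` to `xbar` and `φ = f x - f xbar`.  Each iteration makes
linear progress in one of two senses, and the two together give the rate `exp (-b √k)`.

*The radius.*  The Goldstein modulus at `x`, which the bisection estimates, is of the exact order
of `D`.  It is at most `D` because `0 ∈ ∂f(xbar)`.  It is at least of the order of `D`
(`exists_lt_norm_goldsteinSubgrad`): if `‖g_ε(x)‖ ≤ ε`, the aiming condition forces `x` to lie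
within `O(ε)` of `M` (`exists_norm_sub_nearestPoint_le`), the upper Lipschitz condition provides
a subgradient of length `O(ε)` at `p = P_M(x)`, and the tangential part of every subgradient at `p`
is the Riemannian gradient, whose length is of the order of `‖p - xbar‖` by quadratic growth
(`exists_riemannianGrad_bounds`).  So the iteration can be completed and its step length `s` is of
the order of `β D`.

*The step.*  A Goldstein step decreases `f` by at least `s ‖g‖` (`apply_goldstein_step_le`), by a
one-sided mean value inequality that follows from the theorems of Rademacher and Fubini.  If `‖g‖`
is not small, this decrease is of the order of `D`, hence of `φ`, and `φ` contracts by a factor.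
If `‖g‖` is small, then `x` is close to `M` relative to `D`, and by tempered growth the step goes
nearly in the direction of the negative Riemannian gradient at `P_M(x)`; this direction makes an
angle bounded away from `π / 2` with `xbar - x`, so that `D` contracts by a factor
(`exists_le_inner_of_short_subgrad`, `norm_sub_smul_le`).

*The rate.*  Since `φ` never increases and lies between multiples of `D ^ 2` and `D`, among the
first `n ^ 2` steps either there are `n` that contract `φ`, or there are `n` consecutive ones that
contract `D`; in both cases `φ` is of order `q ^ n` afterwards (`forall_le_mul_pow`).

The geometry of `M` is obtained from a local `C²` diffeomorphism of the whole space that flattens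
`M` (`IsC2ManifoldAround.exists_flattening`).
-/

namespace Goldstein

/-! ### Convex hulls and shortest vectors -/

theorem exists_lipschitzOnWith_of_isCompact {V : Type*} [PseudoMetricSpace V] {f : V → ℝ}
    (hf : LocallyLipschitz f) {s : Set V} (hs : IsCompact s) :
    ∃ K : NNReal, LipschitzOnWith K f s :=
  LocallyLipschitzOn.exists_lipschitzOnWith_of_compact hs hf.locallyLipschitzOn

theorem shortest_spec {V : Type*} [NormedAddCommGroup V] {S : Set V} (hS : IsCompact S)
    (hne : S.Nonempty) :
    shortest S ∈ S ∧ ∀ v ∈ S, ‖shortest S‖ ≤ ‖v‖ := by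
  have h : ∃ g ∈ S, ∀ v ∈ S, ‖g‖ ≤ ‖v‖ :=
    hS.exists_isMinOn hne continuous_norm.continuousOn
  rw [shortest, dif_pos h]
  exact h.choose_spec

section InnerProduct

variable {X : Type*} [NormedAddCommGroup X] [InnerProductSpace ℝ X]

/-- The shortest vector `g` of a convex set satisfies `‖g‖ ^ 2 ≤ ⟪v, g⟫` on the set. -/
theorem sq_norm_le_inner_of_shortest {S : Set X} (hS : Convex ℝ S) {g : X} (hg : g ∈ S)
    (hmin : ∀ v ∈ S, ‖g‖ ≤ ‖v‖) {v : X} (hv : v ∈ S) : ‖g‖ ^ 2 ≤ inner ℝ v g := by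
  have : Nonempty S := ⟨⟨g, hg⟩⟩
  have h1 : ‖(0 : X) - g‖ = ⨅ w : S, ‖(0 : X) - w‖ := by
    apply le_antisymm
    · refine le_ciInf fun w => ?_
      simpa using hmin w w.2
    · exact ciInf_le ⟨0, Set.forall_mem_range.2 fun _ => norm_nonneg _⟩ (⟨g, hg⟩ : S)
  have h2 := (norm_eq_iInf_iff_real_inner_le_zero hS hg).1 h1 v hv
  rw [zero_sub, inner_neg_left, inner_sub_right, real_inner_self_eq_norm_sq,
    real_inner_comm] at h2
  linarith

/-- A bound `m ≤ ⟪·, u⟫` on a set extends to its closed convex hull. -/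
theorem le_inner_of_mem_closure_convexHull {S : Set X} {u : X} {m : ℝ}
    (h : ∀ v ∈ S, m ≤ inner ℝ v u) {v : X} (hv : v ∈ closure (convexHull ℝ S)) :
    m ≤ inner ℝ v u := by
  have hlin : IsLinearMap ℝ fun v : X => inner ℝ v u :=
    ⟨fun a b => inner_add_left a b u, fun c a => real_inner_smul_left a u c⟩
  have h1 : convexHull ℝ S ⊆ {v | m ≤ inner ℝ v u} :=
    convexHull_min h (convex_halfSpace_ge hlin m)
  exact closure_minimal h1 (isClosed_le continuous_const (by fun_prop)) hv

end InnerProduct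

section Clarke

variable {X : Type*} [NormedAddCommGroup X] [InnerProductSpace ℝ X] [FiniteDimensional ℝ X]

/-- In finite dimensions the convex hull of a compact set is compact: by Carathéodory's theorem
it is the image of a product of a simplex with finitely many copies of the set. -/
theorem isCompact_convexHull_of_isCompact {s : Set X} (hs : IsCompact s) :
    IsCompact (convexHull ℝ s) := by
  rcases s.eq_empty_or_nonempty with rfl | ⟨z₀, hz₀⟩
  · simp
  set N := Module.finrank ℝ X + 1 with hN
  have hT : IsCompact ((fun p : (Fin N → ℝ) × (Fin N → X) => ∑ i, p.1 i • p.2 i) ''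
      (stdSimplex ℝ (Fin N) ×ˢ Set.pi Set.univ (fun _ => s))) := by
    refine ((isCompact_stdSimplex ℝ (Fin N)).prod (isCompact_univ_pi fun _ => hs)).image ?_
    fun_prop
  convert hT
  apply Set.Subset.antisymm
  · intro x hx
    obtain ⟨ι, _, z, w, hz, hind, hw, hw1, hx⟩ := eq_pos_convex_span_of_mem_convexHull hx
    have hcard : Fintype.card ι ≤ Fintype.card (Fin N) := by
      rw [Fintype.card_fin]
      exact hind.card_le_finrank_succ.trans
        (Nat.add_le_add_right (Submodule.finrank_le _) 1)
    obtain ⟨e⟩ := Function.Embedding.nonempty_of_card_le hcard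
    have hext : ∀ i, Function.extend e w 0 (e i) = w i := fun i => e.injective.extend_apply _ _ i
    have hext' : ∀ i, Function.extend e z (fun _ => z₀) (e i) = z i :=
      fun i => e.injective.extend_apply _ _ i
    have hout : ∀ j ∉ Set.range e, Function.extend e w 0 j = 0 :=
      fun j hj => Function.extend_apply' _ _ _ hj
    refine ⟨(Function.extend e w 0, Function.extend e z fun _ => z₀), ⟨⟨?_, ?_⟩, ?_⟩, ?_⟩
    · intro j
      by_cases hj : j ∈ Set.range e
      · obtain ⟨i, rfl⟩ := hj
        exact (hw i).le.trans_eq (hext i).symm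
      · exact (hout j hj).ge
    · rw [← hw1]
      exact (Fintype.sum_of_injective e e.injective _ _ hout fun i => (hext i).symm).symm
    · intro j _
      by_cases hj : j ∈ Set.range e
      · obtain ⟨i, rfl⟩ := hj
        change Function.extend e z (fun _ => z₀) (e i) ∈ s
        rw [hext']
        exact hz ⟨i, rfl⟩
      · change Function.extend e z (fun _ => z₀) j ∈ s
        rw [Function.extend_apply' _ _ _ hj]
        exact hz₀
    · rw [← hx]
      refine (Fintype.sum_of_injective e e.injective _ _ (fun j hj => ?_) fun i => ?_).symm
      · simp only [hout j hj, zero_smul]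
      · simp only [hext, hext']
  · rintro _ ⟨⟨w, z⟩, ⟨⟨hw, hw1⟩, hz⟩, rfl⟩
    exact (convex_convexHull ℝ s).sum_mem (fun i _ => hw i) hw1
      fun i _ => subset_convexHull ℝ s (hz i trivial)

/-! ### The Clarke subdifferential -/

variable {f : X → ℝ}

theorem convex_clarkeSubdiff (x : X) : Convex ℝ (clarkeSubdiff f x) :=
  (convex_convexHull ℝ _).closure

theorem isClosed_clarkeSubdiff (x : X) : IsClosed (clarkeSubdiff f x) :=
  isClosed_closure

theorem convex_goldsteinSubdiff (ε : ℝ) (x : X) : Convex ℝ (goldsteinSubdiff f ε x) :=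
  convex_convexHull ℝ _

/-- A locally Lipschitz function is differentiable at points arbitrarily close to a given one. -/
theorem frequently_differentiableAt (hf : LocallyLipschitz f) (x : X) :
    ∃ᶠ z in 𝓝 x, DifferentiableAt ℝ f z := by
  borelize X
  obtain ⟨K, t, ht, hK⟩ := hf x
  have hae := hK.ae_differentiableWithinAt_of_mem (μ := MeasureTheory.volume)
  have hd : Dense {z | z ∈ t → DifferentiableWithinAt ℝ f t z} :=
    MeasureTheory.Measure.dense_of_ae hae
  rw [frequently_iff]
  intro U hU
  have hW : interior (U ∩ t) ∈ 𝓝 x := interior_mem_nhds.2 (inter_mem hU ht)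
  obtain ⟨z, hz, hz'⟩ := hd.inter_open_nonempty _ isOpen_interior ⟨x, mem_of_mem_nhds hW⟩
  have hzn : U ∩ t ∈ 𝓝 z := mem_interior_iff_mem_nhds.1 hz
  exact ⟨z, (mem_of_mem_nhds hzn).1, (hz' (mem_of_mem_nhds hzn).2).differentiableAt
    (mem_of_superset hzn Set.inter_subset_right)⟩

theorem norm_gradient (f : X → ℝ) (z : X) : ‖gradient f z‖ = ‖fderiv ℝ f z‖ :=
  (InnerProductSpace.toDual ℝ X).symm.norm_map _

theorem inner_gradient (f : X → ℝ) (z u : X) : inner ℝ (gradient f z) u = fderiv ℝ f z u :=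
  InnerProductSpace.toDual_symm_apply

/-- Outer semicontinuity of the subdifferential, for gradients: a strict lower bound for
`⟪·, u⟫` on `∂f(y)` holds for the gradients near `y`. -/
theorem eventually_lt_inner_gradient (hf : LocallyLipschitz f) {y u : X} {m : ℝ}
    (h : ∀ w ∈ clarkeSubdiff f y, m < inner ℝ w u) :
    ∀ᶠ z in 𝓝 y, DifferentiableAt ℝ f z → m < inner ℝ (gradient f z) u := by
  by_contra hcon
  obtain ⟨K, t, ht, hK⟩ := hf y
  have hfr : ∃ᶠ z in 𝓝 y, (DifferentiableAt ℝ f z ∧ inner ℝ (gradient f z) u ≤ m) ∧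
      gradient f z ∈ closedBall 0 (K : ℝ) := by
    refine ((not_eventually.1 hcon).and_eventually (eventually_mem_nhds_iff.2 ht)).mono ?_
    rintro z ⟨hz, hzt⟩
    push Not at hz
    refine ⟨hz, ?_⟩
    rw [mem_closedBall_zero_iff, norm_gradient]
    exact norm_fderiv_le_of_lipschitzOn ℝ hzt hK
  obtain ⟨z, hz, hP⟩ := exists_seq_forall_of_frequently hfr
  obtain ⟨v, -, φ, hφ, hv⟩ := (isCompact_closedBall (0 : X) (K : ℝ)).tendsto_subseq
    fun n => (hP n).2
  have hmem : v ∈ clarkeSubdiff f y := subset_closure <| subset_convexHull ℝ _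
    ⟨z ∘ φ, fun n => (hP _).1.1, hz.comp hφ.tendsto_atTop, hv⟩
  have hle : inner ℝ v u ≤ m :=
    le_of_tendsto (hv.inner tendsto_const_nhds) (.of_forall fun n => (hP (φ n)).1.2)
  exact (h v hmem).not_ge hle

theorem eventually_le_inner_clarkeSubdiff (hf : LocallyLipschitz f) {y u : X} {m : ℝ}
    (h : ∀ w ∈ clarkeSubdiff f y, m < inner ℝ w u) :
    ∀ᶠ z in 𝓝 y, ∀ w ∈ clarkeSubdiff f z, m ≤ inner ℝ w u := by
  filter_upwards [(eventually_lt_inner_gradient hf h).eventually_nhds] with z hz w hw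
  refine le_inner_of_mem_closure_convexHull ?_ hw
  rintro v ⟨x, hx, hxz, hv⟩
  refine ge_of_tendsto (hv.inner tendsto_const_nhds) ?_
  filter_upwards [hxz.eventually hz] with n hn
  exact (hn (hx n)).le

theorem nonempty_clarkeSubdiff (hf : LocallyLipschitz f) (x : X) :
    (clarkeSubdiff f x).Nonempty := by
  by_contra hne
  rw [Set.not_nonempty_iff_eq_empty] at hne
  have h := eventually_lt_inner_gradient hf (y := x) (u := 0) (m := 0) (by simp [hne])
  obtain ⟨z, hz, hz'⟩ := ((frequently_differentiableAt hf x).and_eventually h).exists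
  simpa using hz' hz

/-- Around every point the subdifferentials are bounded by a local Lipschitz constant. -/
theorem norm_le_of_mem_clarkeSubdiff {x : X} {t : Set X} (ht : t ∈ 𝓝 x) {K : NNReal}
    (hK : LipschitzOnWith K f t) {v : X} (hv : v ∈ clarkeSubdiff f x) : ‖v‖ ≤ K := by
  have h1 : {v : X | ∃ u : ℕ → X, (∀ n, DifferentiableAt ℝ f (u n)) ∧
      Tendsto u atTop (𝓝 x) ∧ Tendsto (fun n => gradient f (u n)) atTop (𝓝 v)} ⊆
      closedBall 0 (K : ℝ) := by
    rintro w ⟨u, -, hux, hw⟩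
    rw [mem_closedBall_zero_iff]
    refine le_of_tendsto hw.norm ?_
    filter_upwards [hux.eventually (eventually_mem_nhds_iff.2 ht)] with n hn
    rw [norm_gradient]
    exact norm_fderiv_le_of_lipschitzOn ℝ hn hK
  have h2 := closure_minimal (convexHull_min h1 (convex_closedBall _ _)) isClosed_closedBall hv
  simpa using h2

theorem isBounded_clarkeSubdiff (hf : LocallyLipschitz f) (x : X) :
    Bornology.IsBounded (clarkeSubdiff f x) := by
  obtain ⟨K, t, ht, hK⟩ := hf x
  exact isBounded_closedBall.subset fun v hv =>
    mem_closedBall_zero_iff.2 (norm_le_of_mem_clarkeSubdiff ht hK hv)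

theorem isCompact_clarkeSubdiff (hf : LocallyLipschitz f) (x : X) :
    IsCompact (clarkeSubdiff f x) :=
  isCompact_of_isClosed_isBounded (isClosed_clarkeSubdiff x) (isBounded_clarkeSubdiff hf x)

/-- The graph of the subdifferential is closed. -/
theorem mem_clarkeSubdiff_of_tendsto (hf : LocallyLipschitz f) {y : X} {v : X} {u w : ℕ → X}
    (hu : Tendsto u atTop (𝓝 y)) (hw : ∀ n, w n ∈ clarkeSubdiff f (u n))
    (hv : Tendsto w atTop (𝓝 v)) : v ∈ clarkeSubdiff f y := by
  by_contra hcon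
  obtain ⟨l, c, hl, hc⟩ := geometric_hahn_banach_point_closed (convex_clarkeSubdiff y)
    (isClosed_clarkeSubdiff y) hcon
  set a := (InnerProductSpace.toDual ℝ X).symm l with ha
  have hla : ∀ b, l b = inner ℝ b a := fun b => by
    rw [real_inner_comm, ha, InnerProductSpace.toDual_symm_apply]
  have h1 := eventually_le_inner_clarkeSubdiff hf (u := a) (m := c)
    fun b hb => (hla b) ▸ hc b hb
  have h2 : c ≤ inner ℝ v a := by
    refine ge_of_tendsto (hv.inner tendsto_const_nhds) ?_
    filter_upwards [hu.eventually h1] with n hn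
    exact hn _ (hw n)
  rw [hla] at hl
  linarith

/-! ### The Goldstein subdifferential -/

theorem clarkeSubdiff_subset_goldsteinSubdiff {ε : ℝ} {x y : X} (hy : y ∈ closedBall x ε) :
    clarkeSubdiff f y ⊆ goldsteinSubdiff f ε x :=
  (Set.subset_biUnion_of_mem hy).trans (subset_convexHull ℝ _)

theorem goldsteinSubdiff_mono {ε ε' : ℝ} (h : ε ≤ ε') (x : X) :
    goldsteinSubdiff f ε x ⊆ goldsteinSubdiff f ε' x :=
  convexHull_mono (Set.biUnion_subset_biUnion_left (closedBall_subset_closedBall h))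

theorem isCompact_goldsteinSubdiff (hf : LocallyLipschitz f) (ε : ℝ) (x : X) :
    IsCompact (goldsteinSubdiff f ε x) := by
  apply isCompact_convexHull_of_isCompact
  obtain ⟨K, hK⟩ : ∃ K : NNReal, LipschitzOnWith K f (closedBall x (ε + 1)) :=
    exists_lipschitzOnWith_of_isCompact hf (isCompact_closedBall _ _)
  rw [isCompact_iff_isSeqCompact]
  intro v hv
  simp only [Set.mem_iUnion] at hv
  choose y hy hvy using hv
  have hbd : ∀ n, v n ∈ closedBall (0 : X) (K : ℝ) := fun n => by
    rw [mem_closedBall_zero_iff]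
    refine norm_le_of_mem_clarkeSubdiff ?_ hK (hvy n)
    have : y n ∈ ball x (ε + 1) := closedBall_subset_ball (by linarith) (hy n)
    exact mem_of_superset (isOpen_ball.mem_nhds this) ball_subset_closedBall
  obtain ⟨⟨y₀, v₀⟩, hmem, φ, hφ, hlim⟩ :=
    ((isCompact_closedBall x ε).prod (isCompact_closedBall (0 : X) (K : ℝ))).tendsto_subseq
      fun n => Set.mk_mem_prod (hy n) (hbd n)
  obtain ⟨h1, h2⟩ := Prod.tendsto_iff _ _ |>.1 hlim
  exact ⟨v₀, Set.mem_biUnion hmem.1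
    (mem_clarkeSubdiff_of_tendsto hf h1 (fun n => hvy (φ n)) h2), φ, hφ, h2⟩

theorem nonempty_goldsteinSubdiff (hf : LocallyLipschitz f) {ε : ℝ} (hε : 0 ≤ ε) (x : X) :
    (goldsteinSubdiff f ε x).Nonempty :=
  (nonempty_clarkeSubdiff hf x).mono
    (clarkeSubdiff_subset_goldsteinSubdiff (mem_closedBall_self hε))

theorem goldsteinSubgrad_mem (hf : LocallyLipschitz f) {ε : ℝ} (hε : 0 ≤ ε) (x : X) :
    goldsteinSubgrad f ε x ∈ goldsteinSubdiff f ε x :=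
  (shortest_spec (isCompact_goldsteinSubdiff hf ε x) (nonempty_goldsteinSubdiff hf hε x)).1

theorem norm_goldsteinSubgrad_le (hf : LocallyLipschitz f) {ε : ℝ} (hε : 0 ≤ ε) {x v : X}
    (hv : v ∈ goldsteinSubdiff f ε x) : ‖goldsteinSubgrad f ε x‖ ≤ ‖v‖ :=
  (shortest_spec (isCompact_goldsteinSubdiff hf ε x) (nonempty_goldsteinSubdiff hf hε x)).2 v hv

theorem norm_goldsteinSubgrad_anti (hf : LocallyLipschitz f) {ε ε' : ℝ} (hε : 0 ≤ ε)
    (h : ε ≤ ε') (x : X) : ‖goldsteinSubgrad f ε' x‖ ≤ ‖goldsteinSubgrad f ε x‖ :=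
  norm_goldsteinSubgrad_le hf (hε.trans h)
    (goldsteinSubdiff_mono h x (goldsteinSubgrad_mem hf hε x))

theorem sq_norm_goldsteinSubgrad_le_inner (hf : LocallyLipschitz f) {ε : ℝ} (hε : 0 ≤ ε)
    {x y v : X} (hy : y ∈ closedBall x ε) (hv : v ∈ clarkeSubdiff f y) :
    ‖goldsteinSubgrad f ε x‖ ^ 2 ≤ inner ℝ v (goldsteinSubgrad f ε x) :=
  sq_norm_le_inner_of_shortest (convex_goldsteinSubdiff ε x) (goldsteinSubgrad_mem hf hε x)
    (fun _ hw => norm_goldsteinSubgrad_le hf hε hw) (clarkeSubdiff_subset_goldsteinSubdiff hy hv)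

/-! ### Descent along Goldstein steps -/

/-- On an open convex set where the gradients satisfy `m ≤ ⟪·, u⟫`, the function grows at rate
at least `m` in the direction `u`.  By Rademacher's theorem and Fubini's theorem, `f` is
differentiable almost everywhere on almost every line parallel to `u`; on such lines the claim
follows by integration, and on the remaining ones by continuity. -/
theorem add_mul_le_of_le_inner_gradient (hf : LocallyLipschitz f) {O : Set X} (hO : IsOpen O)
    (hconv : Convex ℝ O) {u : X} {m : ℝ}
    (h : ∀ z ∈ O, DifferentiableAt ℝ f z → m ≤ inner ℝ (gradient f z) u) {x : X} {s : ℝ}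
    (hs : 0 ≤ s) (hx : x ∈ O) (hxs : x + s • u ∈ O) : f x + s * m ≤ f (x + s • u) := by
  borelize X
  have hae : ∀ᵐ z : X, z ∈ {z : X | DifferentiableAt ℝ f z} := by
    -- `f` is Lipschitz on each ball, hence differentiable almost everywhere on it
    have h1 : ∀ n : ℕ, ∀ᵐ z : X, z ∈ ball (0 : X) n → DifferentiableAt ℝ f z := by
      intro n
      obtain ⟨K, hK⟩ : ∃ K : NNReal, LipschitzOnWith K f (closedBall 0 (n : ℝ)) :=
        exists_lipschitzOnWith_of_isCompact hf (isCompact_closedBall _ _)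
      filter_upwards [(hK.mono ball_subset_closedBall).ae_differentiableWithinAt_of_mem
        (μ := MeasureTheory.volume)] with z hz hzn
      exact (hz hzn).differentiableAt (isOpen_ball.mem_nhds hzn)
    filter_upwards [MeasureTheory.ae_all_iff.2 h1] with z hz
    obtain ⟨n, hn⟩ := exists_nat_gt ‖z‖
    exact hz n (by simpa using hn)
  have hline : ∀ᵐ y : X, ∀ᵐ t : ℝ, y + (LinearMap.toSpanSingleton ℝ X u) t ∈
      {z : X | DifferentiableAt ℝ f z} :=
    (MeasureTheory.ae_ae_add_linearMap_mem_iff (LinearMap.toSpanSingleton ℝ X u)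
      MeasureTheory.volume MeasureTheory.volume (measurableSet_of_differentiableAt ℝ f)).2 hae
  have hdense := MeasureTheory.Measure.dense_of_ae hline
  -- the claim on almost every line
  have hgood : ∀ y ∈ {y : X | ∀ᵐ t : ℝ, y + (LinearMap.toSpanSingleton ℝ X u) t ∈
      {z : X | DifferentiableAt ℝ f z}}, y ∈ O → y + s • u ∈ O →
      f y + s * m ≤ f (y + s • u) := by
    intro y hy hyO hysO
    have hray : ∀ t ∈ Set.Icc 0 s, y + t • u ∈ O := by
      intro t ht
      rcases hs.eq_or_lt with rfl | hs'
      · obtain rfl : t = 0 := le_antisymm ht.2 ht.1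
        simpa using hyO
      · have := hconv.add_smul_mem hyO hysO (t := t / s)
          ⟨div_nonneg ht.1 hs, div_le_one_of_le₀ ht.2 hs⟩
        rwa [smul_smul, div_mul_cancel₀ _ hs'.ne'] at this
    set r : ℝ → ℝ := fun t => f (y + t • u) with hr
    have haff : LocallyLipschitz fun t : ℝ => y + t • u :=
      ContDiff.locallyLipschitz (𝕂 := ℝ) (by fun_prop)
    have hrl : LocallyLipschitz r := hf.comp haff
    obtain ⟨K, hK⟩ : ∃ K : NNReal, LipschitzOnWith K r (Set.uIcc 0 s) :=
      exists_lipschitzOnWith_of_isCompact hrl isCompact_uIcc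
    have hac := hK.absolutelyContinuousOnInterval
    have hint := hac.integral_deriv_eq_sub
    have hder : ∀ᵐ t : ℝ, t ∈ Set.Icc 0 s → m ≤ deriv r t := by
      filter_upwards [hy] with t ht hts
      have hd : DifferentiableAt ℝ f (y + t • u) := ht
      have h3 : HasDerivAt (fun t : ℝ => y + t • u) u t := by
        simpa using ((hasDerivAt_id t).smul_const u).const_add y
      have h2 : HasDerivAt r (fderiv ℝ f (y + t • u) u) t := hd.hasFDerivAt.comp_hasDerivAt t h3
      rw [h2.deriv, ← inner_gradient]
      exact h _ (hray t hts) hd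
    have hmono : ∫ _t in (0 : ℝ)..s, m ≤ ∫ t in (0 : ℝ)..s, deriv r t := by
      refine intervalIntegral.integral_mono_ae_restrict hs (by simp)
        hac.intervalIntegrable_deriv ?_
      exact (MeasureTheory.ae_restrict_iff' measurableSet_Icc).2 hder
    rw [hint, intervalIntegral.integral_const, smul_eq_mul] at hmono
    simp only [hr, zero_smul, add_zero] at hmono
    linarith
  have hcont := hf.continuous
  have hnear : ∀ᶠ y in 𝓝 x, y ∈ O ∧ y + s • u ∈ O := by
    refine (hO.eventually_mem hx).and ?_
    have : ContinuousAt (fun y : X => y + s • u) x := by fun_prop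
    exact this.eventually (hO.eventually_mem hxs)
  by_contra hlt
  push Not at hlt
  have hop : ∀ᶠ y in 𝓝 x, f (y + s • u) < f y + s * m := by
    have h1 : ContinuousAt (fun y : X => f (y + s • u)) x := by fun_prop
    have h2 : ContinuousAt (fun y : X => f y + s * m) x := by fun_prop
    exact h1.eventually_lt h2 hlt
  obtain ⟨y, hy, hyd⟩ := mem_closure_iff_frequently.1 (hdense x) |>.and_eventually
    (hnear.and hop) |>.exists
  exact hyd.2.not_ge (hgood y hy hyd.1.1 hyd.1.2)

/-- A one-sided mean value inequality: if `m ≤ ⟪·, u⟫` on the subdifferentials along a segment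
in direction `u`, then `f` grows along the segment at rate at least `m`. -/
theorem add_mul_le_of_le_inner_clarkeSubdiff (hf : LocallyLipschitz f) {x u : X} {s m : ℝ}
    (hs : 0 ≤ s) (h : ∀ z ∈ segment ℝ x (x + s • u), ∀ v ∈ clarkeSubdiff f z, m ≤ inner ℝ v u) :
    f x + s * m ≤ f (x + s • u) := by
  have key : ∀ η > 0, f x + s * (m - η) ≤ f (x + s • u) := by
    intro η hη
    set N : Set X :=
      {z | ∀ᶠ z' in 𝓝 z, DifferentiableAt ℝ f z' → m - η < inner ℝ (gradient f z') u} with hN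
    have hNo : IsOpen N := isOpen_setOfPred_eventually_nhds
    have hsub : segment ℝ x (x + s • u) ⊆ N := fun z hz =>
      eventually_lt_inner_gradient hf fun w hw => by linarith [h z hz w hw]
    have hcpt : IsCompact (segment ℝ x (x + s • u)) := by
      rw [segment_eq_image_lineMap]
      exact isCompact_Icc.image (by fun_prop)
    obtain ⟨δ, hδ, hδN⟩ := hcpt.exists_thickening_subset_open hNo hsub
    have hself := self_subset_thickening hδ (segment ℝ x (x + s • u))
    exact add_mul_le_of_le_inner_gradient hf isOpen_thickening
      ((convex_segment _ _).thickening δ) (fun z hz hd => ((hδN hz).self_of_nhds hd).le) hs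
      (hself (left_mem_segment ℝ _ _)) (hself (right_mem_segment ℝ _ _))
  have hlim : Tendsto (fun η : ℝ => f x + s * (m - η)) (𝓝[>] 0) (𝓝 (f x + s * (m - 0))) := by
    apply tendsto_nhdsWithin_of_tendsto_nhds
    exact Continuous.tendsto (by fun_prop) 0
  rw [sub_zero] at hlim
  exact le_of_tendsto hlim (eventually_mem_nhdsWithin.mono fun η hη => key η hη)

/-- A Goldstein step of length `s` decreases `f` by at least `s * ‖g_s(x)‖`. -/
theorem apply_goldstein_step_le (hf : LocallyLipschitz f) {s : ℝ} (hs : 0 ≤ s) (x : X) :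
    f (x - (s / ‖goldsteinSubgrad f s x‖) • goldsteinSubgrad f s x) ≤
      f x - s * ‖goldsteinSubgrad f s x‖ := by
  set g := goldsteinSubgrad f s x with hg
  rcases eq_or_ne g 0 with h0 | h0
  · simp [h0]
  have hpos : 0 < ‖g‖ := norm_pos_iff.2 h0
  set y := x - (s / ‖g‖) • g with hy
  have hyx : y + s • (‖g‖⁻¹ • g) = x := by
    rw [hy, smul_smul, div_eq_mul_inv]; abel
  have hyball : y ∈ closedBall x s := by
    rw [mem_closedBall, dist_eq_norm, hy, sub_sub_cancel_left, norm_neg, norm_smul,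
      Real.norm_of_nonneg (by positivity), div_mul_cancel₀ _ hpos.ne']
  have := add_mul_le_of_le_inner_clarkeSubdiff hf (x := y) (u := ‖g‖⁻¹ • g) (m := ‖g‖) hs ?_
  · rw [hyx] at this
    linarith
  · rw [hyx]
    intro z hz v hv
    have hzb := (convex_closedBall x s).segment_subset hyball (mem_closedBall_self hs) hz
    have h1 := sq_norm_goldsteinSubgrad_le_inner hf hs hzb hv
    rw [← hg] at h1
    rw [inner_smul_right, le_inv_mul_iff₀ hpos, ← sq]
    exact h1

end Clarke

/-! ### Local parametrizations of `C²` manifolds -/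

/-- A map that is `C²` at `a` is, near `a`, differentiable with a Lipschitz derivative, and its
first-order expansions have a uniformly quadratic error. -/
theorem exists_ball_fderiv_lipschitz {V E : Type*} [NormedAddCommGroup V] [NormedSpace ℝ V]
    [NormedAddCommGroup E] [NormedSpace ℝ E] {F : V → E} {a : V} (hF : ContDiffAt ℝ 2 F a) :
    ∃ C r : ℝ, 0 < C ∧ 0 < r ∧ (∀ x ∈ ball a r, DifferentiableAt ℝ F x) ∧
      (∀ x ∈ ball a r, ∀ y ∈ ball a r, ‖fderiv ℝ F x - fderiv ℝ F y‖ ≤ C * ‖x - y‖) ∧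
      ∀ x ∈ ball a r, ∀ y ∈ ball a r,
        ‖F y - F x - fderiv ℝ F x (y - x)‖ ≤ C * ‖y - x‖ ^ 2 := by
  have h1 : ContDiffAt ℝ 1 (fderiv ℝ F) a := hF.fderiv_right (by norm_num)
  obtain ⟨K, t, ht, hK⟩ := h1.exists_lipschitzOnWith
  have hd : ∀ᶠ x in 𝓝 a, DifferentiableAt ℝ F x :=
    (hF.eventually (by simp)).mono fun x hx => hx.differentiableAt (by simp)
  obtain ⟨r, hr, hball⟩ := Metric.eventually_nhds_iff_ball.1 (hd.and ht)
  have hlip : ∀ x ∈ ball a r, ∀ y ∈ ball a r,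
      ‖fderiv ℝ F x - fderiv ℝ F y‖ ≤ (K + 1) * ‖x - y‖ := by
    intro x hx y hy
    have := hK.norm_sub_le (hball x hx).2 (hball y hy).2
    nlinarith [norm_nonneg (x - y)]
  refine ⟨K + 1, r, by positivity, hr, fun x hx => (hball x hx).1, hlip, ?_⟩
  intro x hx y hy
  have hseg := (convex_ball a r).segment_subset hx hy
  have := (convex_segment x y).norm_image_sub_le_of_norm_hasFDerivWithin_le'
    (f := F) (f' := fderiv ℝ F) (φ := fderiv ℝ F x) (C := (K + 1) * ‖y - x‖)
    (fun z hz => (hball z (hseg hz)).1.hasFDerivAt.hasFDerivWithinAt)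
    (fun z hz => (hlip z (hseg hz) x hx).trans ?_)
    (left_mem_segment ℝ x y) (right_mem_segment ℝ x y)
  · rw [sq, ← mul_assoc]
    exact this
  · gcongr
    simpa [dist_eq_norm, norm_sub_rev] using norm_sub_le_of_mem_segment hz

section LocalParam

variable {X : Type*} [NormedAddCommGroup X] [InnerProductSpace ℝ X]

/-- A local parametrization of `M` around `xbar` by a linear subspace `W` of the ambient space:
a `C²` map `Ψ` that is defined around `0` in the whole space, is bi-Lipschitz there, and maps a
neighbourhood of `0` in `W` onto a neighbourhood of `xbar` in `M`. -/
structure LocalParam (M : Set X) (xbar : X) where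
  /-- The space of parameters. -/
  W : Submodule ℝ X
  /-- The parametrizing map. -/
  Ψ : X → X
  /-- The constant in the quadratic error bound. -/
  C : ℝ
  /-- The radius of validity in the parameter space. -/
  r : ℝ
  /-- The radius of the part of `M` that is parametrized. -/
  ρ : ℝ
  C_pos : 0 < C
  r_pos : 0 < r
  ρ_pos : 0 < ρ
  contDiffAt : ContDiffAt ℝ 2 Ψ 0
  map_zero : Ψ 0 = xbar
  surj : ∀ p ∈ M, ‖p - xbar‖ < ρ → ∃ w ∈ W, ‖w‖ < r ∧ Ψ w = p
  mem : ∀ w ∈ W, ‖w‖ < r → Ψ w ∈ M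
  diff : ∀ w, ‖w‖ < r → DifferentiableAt ℝ Ψ w
  expand : ∀ w w', ‖w‖ < r → ‖w'‖ < r →
    ‖Ψ w' - Ψ w - fderiv ℝ Ψ w (w' - w)‖ ≤ C * ‖w' - w‖ ^ 2
  norm_sub_le : ∀ w w', ‖w‖ < r → ‖w'‖ < r → ‖w' - w‖ ≤ 2 * ‖Ψ w' - Ψ w‖
  norm_map_sub_le : ∀ w w', ‖w‖ < r → ‖w'‖ < r → ‖Ψ w' - Ψ w‖ ≤ 2 * ‖w' - w‖
  norm_le_fderiv : ∀ w v, ‖w‖ < r → ‖v‖ ≤ 2 * ‖fderiv ℝ Ψ w v‖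
  tangent : ∀ w ∈ W, ‖w‖ < r → tangentSpaceAt M (Ψ w) = W.map (fderiv ℝ Ψ w : X →ₗ[ℝ] X)

/-- Around `xbar` a `C²` manifold is flattened by a local `C²` diffeomorphism: if `M = {F = 0}`
near `xbar` and `S` is a right inverse of `A = F'(xbar)`, then
`Φ(x) = (x - xbar) + S (F x - A (x - xbar))` has derivative `id` at `xbar` and satisfies
`A (Φ x) = F x`, so that `M = Φ⁻¹ (ker A)` near `xbar`. -/
theorem IsC2ManifoldAround.exists_flattening [FiniteDimensional ℝ X] {M : Set X} {xbar : X}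
    (hM : IsC2ManifoldAround M xbar) :
    ∃ (W : Submodule ℝ X) (Φ Ψ : X → X), ContDiffAt ℝ 2 Φ xbar ∧ ContDiffAt ℝ 2 Ψ 0 ∧
      Φ xbar = 0 ∧ Ψ 0 = xbar ∧ HasFDerivAt Ψ (ContinuousLinearMap.id ℝ X) 0 ∧
      (∀ᶠ x in 𝓝 xbar, Ψ (Φ x) = x) ∧ (∀ᶠ w in 𝓝 0, Φ (Ψ w) = w) ∧
      ∀ᶠ x in 𝓝 xbar, (x ∈ M ↔ Φ x ∈ W) := by
  obtain ⟨hxM, m, F, U, hU, hxU, hF, hsurj, hMU⟩ := hM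
  set A := fderiv ℝ F xbar with hA
  obtain ⟨S', hS'⟩ := (A : X →ₗ[ℝ] EuclideanSpace ℝ (Fin m)).exists_rightInverse_of_surjective
    (LinearMap.range_eq_top.2 hsurj)
  set S : EuclideanSpace ℝ (Fin m) →L[ℝ] X := LinearMap.toContinuousLinearMap S' with hS
  have hAS : ∀ z, A (S z) = z := fun z => LinearMap.congr_fun hS' z
  have hFx : ContDiffAt ℝ 2 F xbar := hF.contDiffAt (hU.mem_nhds hxU)
  have hF0 : F xbar = 0 := by
    have : xbar ∈ M ∩ U := ⟨hxM, hxU⟩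
    rw [hMU] at this
    exact this.2
  set Φ : X → X := fun x => (x - xbar) + S (F x - A (x - xbar)) with hΦ
  have hΦc : ContDiffAt ℝ 2 Φ xbar := by
    have h1 : ContDiffAt ℝ 2 (fun x => F x - A (x - xbar)) xbar := by fun_prop
    have h2 : ContDiffAt ℝ 2 (fun x => S (F x - A (x - xbar))) xbar :=
      S.contDiff.contDiffAt.comp xbar h1
    exact (contDiffAt_id.sub contDiffAt_const).add h2
  have hΦ0 : Φ xbar = 0 := by simp [hΦ, hF0]
  have hFd : HasFDerivAt F A xbar := (hFx.differentiableAt (by simp)).hasFDerivAt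
  have hΦd : HasFDerivAt Φ ((ContinuousLinearEquiv.refl ℝ X : X ≃L[ℝ] X) : X →L[ℝ] X) xbar := by
    have h1 : HasFDerivAt (fun x : X => x - xbar) (ContinuousLinearMap.id ℝ X) xbar :=
      (hasFDerivAt_id xbar).sub_const xbar
    have h2 : HasFDerivAt (fun x : X => A (x - xbar)) A xbar := by
      have := A.hasFDerivAt.comp xbar h1
      rwa [ContinuousLinearMap.comp_id] at this
    have h3 := h1.add (S.hasFDerivAt.comp xbar (hFd.sub h2))
    refine h3.congr_fderiv ?_
    ext v
    simp
  have hn : (2 : WithTop ℕ∞) ≠ 0 := by simp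
  have hstrict := hΦc.hasStrictFDerivAt' hΦd hn
  set Ψ := hΦc.localInverse hΦd hn with hΨ
  have hΨc : ContDiffAt ℝ 2 Ψ 0 := by
    have := hΦc.to_localInverse hΦd hn
    rwa [hΦ0] at this
  refine ⟨LinearMap.ker (A : X →ₗ[ℝ] EuclideanSpace ℝ (Fin m)), Φ, Ψ, hΦc, hΨc, hΦ0, ?_, ?_,
    hstrict.eventually_left_inverse, ?_, ?_⟩
  · have := hΦc.localInverse_apply_image hΦd hn
    rwa [hΦ0] at this
  · have := hstrict.to_localInverse.hasFDerivAt
    rw [hΦ0] at this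
    exact this
  · have := hstrict.eventually_right_inverse
    rwa [hΦ0] at this
  · filter_upwards [hU.mem_nhds hxU] with x hx
    have h1 : A (Φ x) = F x := by simp [hΦ, hAS]
    have h2 : x ∈ M ↔ x ∈ M ∩ U := by simp [hx]
    rw [h2, hMU, LinearMap.mem_ker]
    change (x ∈ U ∧ F x = 0) ↔ A (Φ x) = 0
    rw [h1]
    simp [hx]

theorem IsC2ManifoldAround.nonempty_localParam [FiniteDimensional ℝ X] {M : Set X} {xbar : X}
    (hM : IsC2ManifoldAround M xbar) : Nonempty (LocalParam M xbar) := by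
  obtain ⟨W, Φ, Ψ, hΦ, hΨ, hΦ0, hΨ0, hΨd, hleft, hright, hMW⟩ := hM.exists_flattening
  obtain ⟨C, r₀, hC, hr₀, hdiff, hlip, hexp⟩ := exists_ball_fderiv_lipschitz hΨ
  have hΨcont : ContinuousAt Ψ 0 := hΨ.continuousAt
  have hΨtend : Tendsto Ψ (𝓝 0) (𝓝 xbar) := hΨ0 ▸ hΨcont.tendsto
  have hΦtend : Tendsto Φ (𝓝 xbar) (𝓝 0) := hΦ0 ▸ hΦ.continuousAt.tendsto
  have hΦdiff : ∀ᶠ x in 𝓝 xbar, DifferentiableAt ℝ Φ x :=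
    (hΦ.eventually (by simp)).mono fun x hx => hx.differentiableAt (by simp)
  have hev : ∀ᶠ w in 𝓝 (0 : X), (∀ᶠ x in 𝓝 (Ψ w), Ψ (Φ x) = x ∧ (x ∈ M ↔ Φ x ∈ W)) ∧
      DifferentiableAt ℝ Φ (Ψ w) ∧ ∀ᶠ w' in 𝓝 w, Φ (Ψ w') = w' :=
    (hΨtend.eventually (hleft.and hMW).eventually_nhds).and
      ((hΨtend.eventually hΦdiff).and hright.eventually_nhds)
  obtain ⟨r₁, hr₁, hball⟩ := Metric.eventually_nhds_iff_ball.1 hev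
  set r := min (min r₀ r₁) (1 / (16 * C)) with hrdef
  have hr : 0 < r := by positivity
  have hrr₀ : ∀ w : X, ‖w‖ < r → w ∈ ball (0 : X) r₀ := fun w hw => by
    simpa using hw.trans_le ((min_le_left _ _).trans (min_le_left _ _))
  have hrr₁ : ∀ w : X, ‖w‖ < r → w ∈ ball (0 : X) r₁ := fun w hw => by
    simpa using hw.trans_le ((min_le_left _ _).trans (min_le_right _ _))
  have hrC : C * r ≤ 1 / 16 := by
    have : r ≤ 1 / (16 * C) := min_le_right _ _
    rw [le_div_iff₀ (by positivity)] at this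
    linarith
  -- the derivative is close to the identity
  have hclose : ∀ w v : X, ‖w‖ < r → ‖fderiv ℝ Ψ w v - v‖ ≤ 1 / 16 * ‖v‖ := by
    intro w v hw
    have h1 := hlip w (hrr₀ w hw) 0 (mem_ball_self hr₀)
    rw [hΨd.fderiv, sub_zero] at h1
    calc ‖fderiv ℝ Ψ w v - v‖ = ‖(fderiv ℝ Ψ w - ContinuousLinearMap.id ℝ X) v‖ := by simp
      _ ≤ ‖fderiv ℝ Ψ w - ContinuousLinearMap.id ℝ X‖ * ‖v‖ := ContinuousLinearMap.le_opNorm _ _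
      _ ≤ 1 / 16 * ‖v‖ := by
        gcongr
        nlinarith
  have hdist : ∀ w w' : X, ‖w‖ < r → ‖w'‖ < r →
      ‖Ψ w' - Ψ w - (w' - w)‖ ≤ 1 / 4 * ‖w' - w‖ := by
    intro w w' hw hw'
    have h1 := hexp w (hrr₀ w hw) w' (hrr₀ w' hw')
    have h2 := hclose w (w' - w) hw
    have h3 : ‖w' - w‖ ≤ 2 * r := (norm_sub_le _ _).trans (by linarith)
    have h4 : Ψ w' - Ψ w - (w' - w) = (Ψ w' - Ψ w - fderiv ℝ Ψ w (w' - w)) +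
        (fderiv ℝ Ψ w (w' - w) - (w' - w)) := by abel
    rw [h4]
    refine (norm_add_le _ _).trans ?_
    have h5 : C * ‖w' - w‖ ^ 2 ≤ 1 / 8 * ‖w' - w‖ := by
      rw [sq, ← mul_assoc]
      gcongr
      nlinarith
    linarith [norm_nonneg (w' - w)]
  have htan : ∀ w ∈ W, ‖w‖ < r →
      tangentSpaceAt M (Ψ w) = W.map (fderiv ℝ Ψ w : X →ₗ[ℝ] X) := by
    intro w hwW hw
    obtain ⟨hx, hΦw, hw'⟩ := hball w (hrr₁ w hw)
    have hΨw := hdiff w (hrr₀ w hw)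
    have hwΦ : Φ (Ψ w) = w := hw'.self_of_nhds
    apply le_antisymm
    · refine Submodule.span_le.2 fun y hy => ?_
      have h1 : HasFDerivAt (fun x => Ψ (Φ x))
          ((fderiv ℝ Ψ w).comp (fderiv ℝ Φ (Ψ w))) (Ψ w) := by
        refine HasFDerivAt.comp (Ψ w) ?_ hΦw.hasFDerivAt
        rw [hwΦ]
        exact hΨw.hasFDerivAt
      have h2 : HasFDerivAt (fun x => Ψ (Φ x)) (ContinuousLinearMap.id ℝ X) (Ψ w) :=
        (hasFDerivAt_id (Ψ w)).congr_of_eventuallyEq (hx.mono fun x hx => hx.1)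
      have h3 := congrArg (fun l : X →L[ℝ] X => l y) (h1.unique h2)
      refine ⟨fderiv ℝ Φ (Ψ w) y, ?_, h3⟩
      obtain ⟨N, hN, hNo, hwN⟩ := _root_.eventually_nhds_iff.1 hx
      have h4 : y ∈ tangentConeAt ℝ (M ∩ N) (Ψ w) := by
        refine tangentConeAt_mono_nhds ?_ hy
        rw [nhdsWithin_inter_of_mem']
        exact mem_nhdsWithin_of_mem_nhds (hNo.mem_nhds hwN)
      have h5 := hΦw.hasFDerivAt.hasFDerivWithinAt.mapsTo_tangent_cone h4
      have h6 : fderiv ℝ Φ (Ψ w) y ∈ tangentConeAt ℝ (W : Set X) (Φ (Ψ w)) := by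
        refine tangentConeAt_mono ?_ h5
        rintro _ ⟨x, ⟨hxM, hxN⟩, rfl⟩
        exact (hN x hxN).2.1 hxM
      obtain ⟨ι, l, hl, c, d, -, hd, hcd⟩ := exists_fun_of_mem_tangentConeAt h6
      refine (Submodule.closed_of_finiteDimensional W).mem_of_tendsto hcd (hd.mono fun n hn => ?_)
      rw [hwΦ] at hn
      exact W.smul_mem _ ((W.add_mem_iff_right hwW).1 hn)
    · rintro _ ⟨v, hv, rfl⟩
      apply Submodule.subset_span
      have h1 : HasDerivAt (fun t : ℝ => Ψ (w + t • v)) (fderiv ℝ Ψ w v) 0 := by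
        have h2 : HasDerivAt (fun t : ℝ => w + t • v) v 0 := by
          simpa using ((hasDerivAt_id (0 : ℝ)).smul_const v).const_add w
        have h3 : HasFDerivAt Ψ (fderiv ℝ Ψ w) (w + (0 : ℝ) • v) := by
          simpa using hΨw.hasFDerivAt
        exact h3.comp_hasDerivAt (0 : ℝ) h2
      have h2 := hasDerivAt_iff_tendsto_slope.1 h1
      have hcont : Tendsto (fun t : ℝ => Ψ (w + t • v)) (𝓝 0) (𝓝 (Ψ w)) := by
        simpa using h1.continuousAt.tendsto
      have hcont' : Tendsto (fun t : ℝ => w + t • v) (𝓝 0) (𝓝 w) := by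
        have : Continuous fun t : ℝ => w + t • v := by fun_prop
        simpa using this.tendsto 0
      refine mem_tangentConeAt_of_seq (𝓝[≠] (0 : ℝ)) (fun t => t⁻¹)
        (fun t => Ψ (w + t • v) - Ψ w) ?_ ?_ ?_
      · rw [← sub_self (Ψ w)]
        exact (hcont.sub_const _).mono_left nhdsWithin_le_nhds
      · refine Eventually.filter_mono nhdsWithin_le_nhds ?_
        filter_upwards [hcont.eventually hx, hcont'.eventually hw'] with t ht ht'
        rw [add_sub_cancel, ht.2, ht']
        exact W.add_mem hwW (W.smul_mem _ hv)
      · refine h2.congr fun t => ?_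
        simp [slope]
  have hmem : ∀ w ∈ W, ‖w‖ < r → Ψ w ∈ M := by
    intro w hwW hw
    obtain ⟨hx, -, hw'⟩ := hball w (hrr₁ w hw)
    rw [hx.self_of_nhds.2, hw'.self_of_nhds]
    exact hwW
  have hsurj : ∀ᶠ x in 𝓝 xbar, x ∈ M → ∃ w ∈ W, ‖w‖ < r ∧ Ψ w = x := by
    filter_upwards [hleft, hMW, hΦtend.eventually (ball_mem_nhds 0 hr)] with x h1 h2 h3 hxM
    exact ⟨Φ x, h2.1 hxM, by simpa using h3, h1⟩
  obtain ⟨ρ, hρ, hρball⟩ := Metric.eventually_nhds_iff_ball.1 hsurj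
  exact ⟨{
    W := W
    Ψ := Ψ
    C := C
    r := r
    ρ := ρ
    C_pos := hC
    r_pos := hr
    ρ_pos := hρ
    contDiffAt := hΨ
    map_zero := hΨ0
    surj := fun p hp hpρ => hρball p (mem_ball_iff_norm.2 hpρ) hp
    mem := hmem
    diff := fun w hw => hdiff w (hrr₀ w hw)
    expand := fun w w' hw hw' => hexp w (hrr₀ w hw) w' (hrr₀ w' hw')
    norm_sub_le := fun w w' hw hw' => by
      have h1 := hdist w w' hw hw'
      have h2 := norm_sub_norm_le (w' - w) (Ψ w' - Ψ w)
      rw [norm_sub_rev (w' - w)] at h2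
      linarith [norm_nonneg (w' - w)]
    norm_map_sub_le := fun w w' hw hw' => by
      have h1 := hdist w w' hw hw'
      have h2 := norm_sub_norm_le (Ψ w' - Ψ w) (w' - w)
      linarith [norm_nonneg (w' - w)]
    norm_le_fderiv := fun w v hw => by
      have h1 := hclose w v hw
      have h2 := norm_sub_norm_le v (fderiv ℝ Ψ w v)
      rw [norm_sub_rev v] at h2
      linarith [norm_nonneg v]
    tangent := htan }⟩

end LocalParam

section Geometry

variable {X : Type*} [NormedAddCommGroup X] [InnerProductSpace ℝ X]
variable {f : X → ℝ} {M : Set X} {xbar : X}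

theorem LocalParam.exists_param_norm_lt (P : LocalParam M xbar) {r' : ℝ} (hr' : 0 < r') :
    ∃ ρ > 0, ∀ p ∈ M, ‖p - xbar‖ < ρ → ∃ w ∈ P.W, ‖w‖ < P.r ∧ ‖w‖ < r' ∧ P.Ψ w = p := by
  refine ⟨min P.ρ (r' / 2), lt_min P.ρ_pos (by positivity), fun p hp hpρ => ?_⟩
  obtain ⟨w, hwW, hw, rfl⟩ := P.surj p hp (hpρ.trans_le (min_le_left _ _))
  refine ⟨w, hwW, hw, ?_, rfl⟩
  have h1 := P.norm_sub_le 0 w (by simpa using P.r_pos) hw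
  rw [P.map_zero, sub_zero] at h1
  linarith [hpρ.trans_le (min_le_right P.ρ (r' / 2))]

/-! ### Nearest points -/

/-- Near `xbar` the nearest points exist, because `M` is locally closed. -/
theorem IsC2ManifoldAround.exists_nearestPoint_spec [FiniteDimensional ℝ X]
    (hM : IsC2ManifoldAround M xbar) :
    ∃ r > 0, ∀ x, ‖x - xbar‖ < r →
      nearestPoint M x ∈ M ∧ ∀ q ∈ M, ‖x - nearestPoint M x‖ ≤ ‖x - q‖ := by
  obtain ⟨hxM, m, F, U, hU, hxU, hF, -, hMU⟩ := hM
  obtain ⟨R, hR, hRU⟩ := nhds_basis_closedBall.mem_iff.1 (hU.mem_nhds hxU)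
  have hset : M ∩ closedBall xbar R = closedBall xbar R ∩ F ⁻¹' {0} := by
    ext x
    have h := Set.ext_iff.1 hMU x
    constructor
    · rintro ⟨h1, h2⟩
      exact ⟨h2, (h.1 ⟨h1, hRU h2⟩).2⟩
    · rintro ⟨h1, h2⟩
      exact ⟨(h.2 ⟨hRU h1, h2⟩).1, h1⟩
  have hcpt : IsCompact (M ∩ closedBall xbar R) := by
    refine (isCompact_closedBall xbar R).of_isClosed_subset ?_ Set.inter_subset_right
    rw [hset]
    exact (hF.continuousOn.mono hRU).preimage_isClosed_of_isClosed isClosed_closedBall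
      isClosed_singleton
  refine ⟨R / 2, by positivity, fun x hx => ?_⟩
  have hne : xbar ∈ M ∩ closedBall xbar R := ⟨hxM, mem_closedBall_self hR.le⟩
  obtain ⟨p, hp, hmin⟩ := hcpt.exists_isMinOn ⟨xbar, hne⟩
    (f := fun q => ‖x - q‖) (by fun_prop)
  have h : ∃ p ∈ M, ∀ q ∈ M, ‖x - p‖ ≤ ‖x - q‖ := by
    refine ⟨p, hp.1, fun q hq => ?_⟩
    by_cases hqR : q ∈ closedBall xbar R
    · exact hmin ⟨hq, hqR⟩
    · -- points outside the ball are farther from `x` than `xbar` is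
      have h1 : ‖x - p‖ ≤ ‖x - xbar‖ := hmin hne
      rw [mem_closedBall_iff_norm, not_le] at hqR
      have h2 : ‖q - xbar‖ ≤ ‖x - q‖ + ‖x - xbar‖ := by
        rw [norm_sub_rev x q]
        exact norm_sub_le_norm_sub_add_norm_sub q x xbar
      linarith
  rw [nearestPoint, dif_pos h]
  exact h.choose_spec

theorem infDist_eq_norm_sub {V : Type*} [SeminormedAddCommGroup V] {M : Set V} {x p : V}
    (hp : p ∈ M) (hmin : ∀ q ∈ M, ‖x - p‖ ≤ ‖x - q‖) :
    infDist x M = ‖x - p‖ := by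
  apply le_antisymm
  · rw [← dist_eq_norm]
    exact infDist_le_dist_of_mem hp
  · exact (le_infDist ⟨p, hp⟩).2 fun q hq => (dist_eq_norm x q).symm ▸ hmin q hq

/-- If `p ∈ M` is a nearest point to `x`, then `x - p` is normal to `M` at `p`, with a
quadratic error that is uniform near `xbar`. -/
theorem LocalParam.exists_inner_le_of_nearest (P : LocalParam M xbar) :
    ∃ κ ρ : ℝ, 0 < κ ∧ 0 < ρ ∧ ∀ x p q : X, p ∈ M → q ∈ M → ‖p - xbar‖ < ρ →
      ‖q - xbar‖ < ρ → (∀ q' ∈ M, ‖x - p‖ ≤ ‖x - q'‖) →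
      inner ℝ (q - p) (x - p) ≤ κ * ‖x - p‖ * ‖q - p‖ ^ 2 := by
  refine ⟨4 * P.C, P.ρ, by linarith [P.C_pos], P.ρ_pos, ?_⟩
  intro x p q hp hq hpρ hqρ hmin
  obtain ⟨w, hwW, hw, rfl⟩ := P.surj p hp hpρ
  obtain ⟨w', hwW', hw', rfl⟩ := P.surj q hq hqρ
  set v := w' - w with hv
  have hvW : v ∈ P.W := P.W.sub_mem hwW' hwW
  -- stationarity of the squared distance along the curve `t ↦ Ψ (w + t v)` in `M`
  have hstat : inner ℝ (fderiv ℝ P.Ψ w v) (x - P.Ψ w) = 0 := by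
    have h2 : HasDerivAt (fun t : ℝ => w + t • v) v 0 := by
      simpa using ((hasDerivAt_id (0 : ℝ)).smul_const v).const_add w
    have h3 : HasFDerivAt P.Ψ (fderiv ℝ P.Ψ w) (w + (0 : ℝ) • v) := by
      simpa using (P.diff w hw).hasFDerivAt
    have h4 : HasDerivAt (fun t : ℝ => x - P.Ψ (w + t • v)) (-fderiv ℝ P.Ψ w v) 0 :=
      (h3.comp_hasDerivAt (0 : ℝ) h2).const_sub x
    have h5 := h4.norm_sq
    have hmin' : IsLocalMin (fun t : ℝ => ‖x - P.Ψ (w + t • v)‖ ^ 2) 0 := by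
      have hc : Tendsto (fun t : ℝ => w + t • v) (𝓝 0) (𝓝 w) := by
        simpa using h2.continuousAt.tendsto
      have : ∀ᶠ t : ℝ in 𝓝 0, ‖w + t • v‖ < P.r := hc.norm.eventually_lt_const hw
      filter_upwards [this] with t ht
      have := hmin _ (P.mem _ (P.W.add_mem hwW (P.W.smul_mem t hvW)) ht)
      simp only [zero_smul, add_zero]
      gcongr
    have h6 := hmin'.hasDerivAt_eq_zero h5
    simp only [zero_smul, add_zero, inner_neg_right] at h6
    rw [real_inner_comm]
    linarith
  have h1 := P.expand w w' hw hw'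
  have h2 := P.norm_sub_le w w' hw hw'
  calc inner ℝ (P.Ψ w' - P.Ψ w) (x - P.Ψ w)
      = inner ℝ (P.Ψ w' - P.Ψ w - fderiv ℝ P.Ψ w v) (x - P.Ψ w) := by
        rw [inner_sub_left (P.Ψ w' - P.Ψ w), hstat, sub_zero]
    _ ≤ ‖P.Ψ w' - P.Ψ w - fderiv ℝ P.Ψ w v‖ * ‖x - P.Ψ w‖ := real_inner_le_norm _ _
    _ ≤ (P.C * (2 * ‖P.Ψ w' - P.Ψ w‖) ^ 2) * ‖x - P.Ψ w‖ := by
        have := P.C_pos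
        gcongr
        exact h1.trans (by gcongr)
    _ = 4 * P.C * ‖x - P.Ψ w‖ * ‖P.Ψ w' - P.Ψ w‖ ^ 2 := by ring

/-- Near `xbar` the projection onto `M` exists and is Lipschitz. -/
theorem IsC2ManifoldAround.exists_nearestPoint_lipschitz [FiniteDimensional ℝ X]
    (hM : IsC2ManifoldAround M xbar) :
    ∃ r > 0, (∀ x, ‖x - xbar‖ < r →
      nearestPoint M x ∈ M ∧ infDist x M = ‖x - nearestPoint M x‖ ∧
        ‖x - nearestPoint M x‖ ≤ ‖x - xbar‖) ∧
      ∀ x y, ‖x - xbar‖ < r → ‖y - xbar‖ < r →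
        ‖nearestPoint M y - nearestPoint M x‖ ≤ 2 * ‖y - x‖ := by
  obtain ⟨r₀, hr₀, hspec⟩ := hM.exists_nearestPoint_spec
  obtain ⟨P⟩ := hM.nonempty_localParam
  obtain ⟨κ, ρ, hκ, hρ, hquad⟩ := P.exists_inner_le_of_nearest
  have hr : 0 < min r₀ (min (ρ / 2) (1 / (4 * κ))) := by positivity
  have hle : ∀ x, ‖x - xbar‖ < min r₀ (min (ρ / 2) (1 / (4 * κ))) →
      ‖x - nearestPoint M x‖ ≤ ‖x - xbar‖ := fun x hx =>
    (hspec x (hx.trans_le (min_le_left _ _))).2 _ hM.1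
  refine ⟨_, hr, fun x hx => ?_, fun x y hx hy => ?_⟩
  · obtain ⟨h1, h2⟩ := hspec x (hx.trans_le (min_le_left _ _))
    exact ⟨h1, infDist_eq_norm_sub h1 h2, h2 _ hM.1⟩
  · have hdx := hle x hx
    have hdy := hle y hy
    obtain ⟨hp, hpmin⟩ := hspec x (hx.trans_le (min_le_left _ _))
    obtain ⟨hq, hqmin⟩ := hspec y (hy.trans_le (min_le_left _ _))
    set p := nearestPoint M x with hpdef
    set q := nearestPoint M y with hqdef
    simp only [lt_min_iff] at hx hy
    have hpb : ‖p - xbar‖ < ρ := by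
      have := norm_sub_le_norm_sub_add_norm_sub p x xbar
      rw [norm_sub_rev p x] at this
      linarith
    have hqb : ‖q - xbar‖ < ρ := by
      have := norm_sub_le_norm_sub_add_norm_sub q y xbar
      rw [norm_sub_rev q y] at this
      linarith
    have h1 := hquad x p q hp hq hpb hqb hpmin
    have h2 := hquad y q p hq hp hqb hpb hqmin
    rw [norm_sub_rev p q] at h2
    have hκx : κ * ‖x - p‖ ≤ 1 / 4 := by
      have h3 : ‖x - p‖ ≤ 1 / (4 * κ) := hdx.trans hx.2.2.le
      rw [le_div_iff₀ (by positivity)] at h3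
      linarith
    have hκy : κ * ‖y - q‖ ≤ 1 / 4 := by
      have h3 : ‖y - q‖ ≤ 1 / (4 * κ) := hdy.trans hy.2.2.le
      rw [le_div_iff₀ (by positivity)] at h3
      linarith
    have h4 : ‖q - p‖ ^ 2 = inner ℝ (q - p) (y - x) + inner ℝ (q - p) (x - p) +
        inner ℝ (p - q) (y - q) := by
      rw [← real_inner_self_eq_norm_sq, ← neg_sub q p, inner_neg_left, ← sub_eq_add_neg,
        ← inner_add_right, ← inner_sub_right]
      congr 1
      abel
    have h5 := real_inner_le_norm (q - p) (y - x)
    have h6 : κ * ‖x - p‖ * ‖q - p‖ ^ 2 ≤ 1 / 4 * ‖q - p‖ ^ 2 := by gcongr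
    have h7 : κ * ‖y - q‖ * ‖q - p‖ ^ 2 ≤ 1 / 4 * ‖q - p‖ ^ 2 := by gcongr
    rcases (norm_nonneg (q - p)).eq_or_lt with h0 | h0
    · rw [← h0]
      positivity
    · have h8 : ‖q - p‖ * ‖q - p‖ ≤ ‖q - p‖ * (2 * ‖y - x‖) := by nlinarith
      exact le_of_mul_le_mul_left h8 h0

/-! ### Second-order growth on a subspace -/

/-- If a function that is `C²` at `0` grows quadratically along a subspace, then along this
subspace its derivative is of linear order, and it grows at least quadratically radially. -/
theorem exists_fderiv_bounds_of_growth {φ : X → ℝ} {W : Submodule ℝ X} {c : ℝ} (hc : 0 < c)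
    (hφ : ContDiffAt ℝ 2 φ 0)
    (hgrowth : ∀ᶠ w in 𝓝 (0 : X), w ∈ W → c * ‖w‖ ^ 2 ≤ φ w - φ 0) :
    ∃ C r : ℝ, 0 < C ∧ 0 < r ∧ ∀ w ∈ W, ‖w‖ < r →
      (∀ v ∈ W, fderiv ℝ φ w v ≤ C * ‖w‖ * ‖v‖) ∧ c * ‖w‖ ^ 2 ≤ fderiv ℝ φ w w := by
  obtain ⟨C, r₀, hC, hr₀, hdiff, hlip, -⟩ := exists_ball_fderiv_lipschitz hφ
  have hcrit : ∀ v ∈ W, fderiv ℝ φ 0 v = 0 := by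
    intro v hv
    have h2 : HasDerivAt (fun t : ℝ => t • v) v 0 := by
      simpa using (hasDerivAt_id (0 : ℝ)).smul_const v
    have h3 : HasFDerivAt φ (fderiv ℝ φ 0) ((0 : ℝ) • v) := by
      simpa using (hdiff 0 (mem_ball_self hr₀)).hasFDerivAt
    have h4 : HasDerivAt (fun t : ℝ => φ (t • v)) (fderiv ℝ φ 0 v) 0 := h3.comp_hasDerivAt 0 h2
    refine IsLocalMin.hasDerivAt_eq_zero ?_ h4
    have hcv : Tendsto (fun t : ℝ => t • v) (𝓝 0) (𝓝 0) := by simpa using h2.continuousAt.tendsto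
    filter_upwards [hcv.eventually hgrowth] with t ht
    have := ht (W.smul_mem t hv)
    have h5 : 0 ≤ c * ‖t • v‖ ^ 2 := by positivity
    simp only [zero_smul]
    linarith
  -- the derivative is linear up to a small relative error
  have hH : DifferentiableAt ℝ (fderiv ℝ φ) 0 :=
    (hφ.fderiv_right (m := 1) (by norm_num)).differentiableAt (by simp)
  set H := fderiv ℝ (fderiv ℝ φ) 0 with hHdef
  have hlin := hH.hasFDerivAt.isLittleO.def (c := c / 4) (by positivity)
  obtain ⟨r₁, hr₁, hball⟩ := Metric.eventually_nhds_iff_ball.1 (hlin.and hgrowth)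
  refine ⟨C, min r₀ r₁, hC, by positivity, fun w hw hwr => ?_⟩
  have hw₀ : w ∈ ball (0 : X) r₀ := by simpa using hwr.trans_le (min_le_left _ _)
  have hw₁ : w ∈ ball (0 : X) r₁ := by simpa using hwr.trans_le (min_le_right _ _)
  constructor
  · intro v hv
    have h1 := hlip w hw₀ 0 (mem_ball_self hr₀)
    rw [sub_zero] at h1
    calc fderiv ℝ φ w v = (fderiv ℝ φ w - fderiv ℝ φ 0) v := by simp [hcrit v hv]
      _ ≤ ‖(fderiv ℝ φ w - fderiv ℝ φ 0) v‖ := le_abs_self _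
      _ ≤ ‖fderiv ℝ φ w - fderiv ℝ φ 0‖ * ‖v‖ := ContinuousLinearMap.le_opNorm _ _
      _ ≤ C * ‖w‖ * ‖v‖ := by gcongr
  · have hseg : ∀ t ∈ Set.Icc (0 : ℝ) 1, ‖t • w‖ ≤ ‖w‖ := by
      intro t ht
      rw [norm_smul, Real.norm_of_nonneg ht.1]
      exact mul_le_of_le_one_left (norm_nonneg w) ht.2
    have herr : ∀ t ∈ Set.Icc (0 : ℝ) 1,
        |fderiv ℝ φ (t • w) w - t * H w w| ≤ c / 4 * ‖w‖ ^ 2 := by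
      intro t ht
      have hmem : t • w ∈ ball (0 : X) r₁ := by
        rw [mem_ball_zero_iff] at hw₁ ⊢
        exact (hseg t ht).trans_lt hw₁
      have h1 := (hball _ hmem).1
      rw [sub_zero] at h1
      calc |fderiv ℝ φ (t • w) w - t * H w w|
          = ‖(fderiv ℝ φ (t • w) - fderiv ℝ φ 0 - H (t • w)) w‖ := by
            simp [hcrit w hw]
        _ ≤ ‖fderiv ℝ φ (t • w) - fderiv ℝ φ 0 - H (t • w)‖ * ‖w‖ :=
            ContinuousLinearMap.le_opNorm _ _
        _ ≤ c / 4 * ‖w‖ * ‖w‖ := by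
            gcongr
            exact h1.trans (by gcongr; exact hseg t ht)
        _ = c / 4 * ‖w‖ ^ 2 := by ring
    -- compare `φ (t w)` with the quadratic function of `t` with the same slope at `t = 1`
    set A := fderiv ℝ φ w w with hA
    have h1 := herr 1 (by simp)
    rw [one_smul, one_mul, ← hA] at h1
    have hk : ∀ t ∈ Set.Icc (0 : ℝ) 1, HasDerivWithinAt
        (fun t : ℝ => φ (t • w) - t ^ 2 / 2 * A) (fderiv ℝ φ (t • w) w - t * A)
        (Set.Icc 0 1) t := by
      intro t ht
      have hmem : t • w ∈ ball (0 : X) r₀ := by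
        rw [mem_ball_zero_iff] at hw₀ ⊢
        exact (hseg t ht).trans_lt hw₀
      have h2 : HasDerivAt (fun t : ℝ => t • w) w t := by
        simpa using (hasDerivAt_id t).smul_const w
      have h3 := (hdiff _ hmem).hasFDerivAt.comp_hasDerivAt t h2
      have h4 : HasDerivAt (fun t : ℝ => t ^ 2 / 2 * A) (t * A) t := by
        have := (((hasDerivAt_id t).pow 2).div_const 2).mul_const A
        convert! this using 1
        simp
      exact (h3.sub h4).hasDerivWithinAt
    have hbound : ∀ t ∈ Set.Ico (0 : ℝ) 1,
        ‖fderiv ℝ φ (t • w) w - t * A‖ ≤ c / 2 * ‖w‖ ^ 2 := by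
      intro t ht
      have h2 := herr t ⟨ht.1, ht.2.le⟩
      have h3 : |t * (A - H w w)| ≤ c / 4 * ‖w‖ ^ 2 := by
        rw [abs_mul, abs_of_nonneg ht.1]
        exact (mul_le_of_le_one_left (abs_nonneg _) ht.2.le).trans h1
      rw [Real.norm_eq_abs]
      rw [abs_le] at h2 h3 ⊢
      constructor <;> linarith
    have h5 := norm_image_sub_le_of_norm_deriv_le_segment_01' hk hbound
    have h6 := (hball w hw₁).2 hw
    simp only [one_smul, zero_smul, Real.norm_eq_abs] at h5
    have h7 := (abs_le.1 h5).2
    linarith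

/-! ### Riemannian gradients and subgradients -/

/-- If a locally Lipschitz function has a derivative along a curve through `p` with velocity `z`,
then it has the same one-sided derivative along the ray from `p` in direction `z`. -/
theorem tendsto_slope_ray_of_curve (hf : LocallyLipschitz f) {p z : X} {γ : ℝ → X} {a : ℝ}
    (hγ : HasDerivAt γ z 0) (hγ0 : γ 0 = p) (hfγ : HasDerivAt (f ∘ γ) a 0) :
    Tendsto (fun t : ℝ => (1 / t) * (f (p + t • z) - f p)) (𝓝[>] 0) (𝓝 a) := by
  obtain ⟨K, s, hs, hK⟩ := hf p
  have h1 : Tendsto (fun t : ℝ => t⁻¹ * (f (γ t) - f p)) (𝓝[>] 0) (𝓝 a) := by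
    have := (hasDerivAt_iff_tendsto_slope.1 hfγ).mono_left (nhdsGT_le_nhdsNE 0)
    refine this.congr fun t => ?_
    simp [slope, hγ0]
  have h2 : Tendsto (fun t : ℝ => t⁻¹ • (γ t - p) - z) (𝓝[>] 0) (𝓝 0) := by
    have := (hasDerivAt_iff_tendsto_slope.1 hγ).mono_left (nhdsGT_le_nhdsNE 0)
    rw [← sub_self z]
    refine (this.sub_const z).congr fun t => ?_
    simp [slope, hγ0]
  have h3 : Tendsto (fun t : ℝ => t⁻¹ * (f (p + t • z) - f (γ t))) (𝓝[>] 0) (𝓝 0) := by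
    have hK0 : Tendsto (fun t : ℝ => (K : ℝ) * ‖t⁻¹ • (γ t - p) - z‖) (𝓝[>] 0) (𝓝 0) := by
      simpa using h2.norm.const_mul (K : ℝ)
    refine squeeze_zero_norm' ?_ hK0
    have h4 : Tendsto (fun t : ℝ => p + t • z) (𝓝 0) (𝓝 p) := by
      have : Continuous fun t : ℝ => p + t • z := by fun_prop
      simpa using this.tendsto 0
    have h5 : Tendsto γ (𝓝 0) (𝓝 p) := hγ0 ▸ hγ.continuousAt.tendsto
    filter_upwards [nhdsWithin_le_nhds (h4.eventually hs), nhdsWithin_le_nhds (h5.eventually hs),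
      self_mem_nhdsWithin] with t ht1 ht2 ht
    have ht0 : (0 : ℝ) < t := ht
    have h6 := hK.norm_sub_le ht1 ht2
    have h7 : p + t • z - γ t = -(t • (t⁻¹ • (γ t - p) - z)) := by
      rw [smul_sub, smul_inv_smul₀ ht0.ne']
      abel
    rw [h7, norm_neg, norm_smul, Real.norm_of_nonneg ht0.le] at h6
    rw [norm_mul, norm_inv, Real.norm_of_nonneg ht0.le, inv_mul_le_iff₀ ht0]
    linarith
  have h8 := h3.add h1
  rw [zero_add] at h8
  refine h8.congr fun t => ?_
  ring

theorem inner_le_clarkeDirDeriv [FiniteDimensional ℝ X]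
    (hf : LocallyLipschitz f) {p v : X} (z : X)
    (hv : v ∈ clarkeSubdiff f p) : inner ℝ v z ≤ clarkeDirDeriv f p z := by
  refine le_csSup ?_ ⟨v, hv, rfl⟩
  exact ((isCompact_clarkeSubdiff hf p).image (by fun_prop)).bddAbove

/-- If `f` is regular at `p` and has a derivative along a curve through `p`, then every subgradient
at `p` represents this derivative: regularity bounds the subgradient from above both along the
curve and along the reversed curve. -/
theorem inner_eq_of_regular [FiniteDimensional ℝ X]
    (hf : LocallyLipschitz f) {p z v : X} (hreg : SubdiffRegularAt f p)
    {γ : ℝ → X} {a : ℝ} (hγ : HasDerivAt γ z 0) (hγ0 : γ 0 = p)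
    (hfγ : HasDerivAt (f ∘ γ) a 0) (hv : v ∈ clarkeSubdiff f p) : inner ℝ v z = a := by
  have h1 : clarkeDirDeriv f p z = a :=
    tendsto_nhds_unique (hreg z) (tendsto_slope_ray_of_curve hf hγ hγ0 hfγ)
  have hneg : HasDerivAt (fun t : ℝ => -t) (-1) 0 := hasDerivAt_neg 0
  have hγ' : HasDerivAt (fun t => γ (-t)) (-z) 0 := by
    have h : HasDerivAt γ z (-0) := by simpa using hγ
    simpa [Function.comp_def] using h.scomp (0 : ℝ) hneg
  have hfγ' : HasDerivAt (f ∘ fun t => γ (-t)) (-a) 0 := by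
    have h : HasDerivAt (f ∘ γ) a (-0) := by simpa using hfγ
    simpa [Function.comp_def] using h.scomp (0 : ℝ) hneg
  have h2 : clarkeDirDeriv f p (-z) = -a :=
    tendsto_nhds_unique (hreg (-z))
      (tendsto_slope_ray_of_curve hf hγ' (by simpa using hγ0) hfγ')
  have h3 := inner_le_clarkeDirDeriv hf z hv
  have h4 := inner_le_clarkeDirDeriv hf (-z) hv
  rw [inner_neg_right] at h4
  linarith

/-- Near `xbar` the Riemannian gradient is of exact order `‖p - xbar‖`, makes an angle bounded
away from `π / 2` with `p - xbar`, and is no longer than any subgradient at `p`, being the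
common tangential part of the subgradients. -/
theorem exists_riemannianGrad_bounds [FiniteDimensional ℝ X]
    (hf : LocallyLipschitz f) (hM : IsC2ManifoldAround M xbar)
    (hquad : GrowsQuadratically f xbar) (hreg : ∀ x ∈ M, SubdiffRegularAt f x)
    (hsm : RestrictionC2At f M xbar) :
    ∃ κ C r : ℝ, 0 < κ ∧ 0 < C ∧ 0 < r ∧ ∀ p ∈ M, ‖p - xbar‖ < r →
      ‖riemannianGrad f M p‖ ≤ C * ‖p - xbar‖ ∧
      κ * ‖p - xbar‖ ^ 2 ≤ inner ℝ (riemannianGrad f M p) (p - xbar) ∧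
      ∀ v ∈ clarkeSubdiff f p, ‖riemannianGrad f M p‖ ≤ ‖v‖ := by
  obtain ⟨P⟩ := hM.nonempty_localParam
  obtain ⟨δ, hδ, hgrow⟩ := hquad
  obtain ⟨h, hh, hhf⟩ := hsm
  have hzero : ‖(0 : X)‖ < P.r := by simpa using P.r_pos
  have hsmall : ∀ᶠ w in 𝓝 (0 : X), ‖w‖ < P.r := by
    filter_upwards [ball_mem_nhds (0 : X) P.r_pos] with w hw using mem_ball_zero_iff.1 hw
  have hΨtend : Tendsto P.Ψ (𝓝 0) (𝓝 xbar) := by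
    simpa only [P.map_zero] using P.contDiffAt.continuousAt.tendsto
  have hhf' : ∀ᶠ x in 𝓝 xbar, x ∈ M → h x = f x := eventually_nhdsWithin_iff.1 hhf
  have hh' : ContDiffAt ℝ 2 h (P.Ψ 0) := by rwa [P.map_zero]
  have hφ : ContDiffAt ℝ 2 (h ∘ P.Ψ) 0 := hh'.comp 0 P.contDiffAt
  have hφg : ∀ᶠ w in 𝓝 (0 : X), w ∈ P.W →
      δ / 8 * ‖w‖ ^ 2 ≤ (h ∘ P.Ψ) w - (h ∘ P.Ψ) 0 := by
    filter_upwards [hsmall, hΨtend.eventually hhf', hΨtend.eventually hgrow] with w hw h1 h2 hwW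
    have h3 := h1 (P.mem w hwW hw)
    have h4 := hhf'.self_of_nhds hM.1
    have h5 := P.norm_sub_le 0 w hzero hw
    rw [sub_zero, P.map_zero] at h5
    simp only [Function.comp_apply, P.map_zero, h3, h4]
    refine le_trans ?_ h2
    have h6 : ‖w‖ ^ 2 ≤ (2 * ‖P.Ψ w - xbar‖) ^ 2 := by gcongr
    nlinarith
  obtain ⟨C, r₁, hC, hr₁, hbounds⟩ := exists_fderiv_bounds_of_growth (by positivity) hφ hφg
  have hev : ∀ᶠ w in 𝓝 (0 : X), (∀ᶠ x in 𝓝 (P.Ψ w), x ∈ M → h x = f x) ∧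
      DifferentiableAt ℝ h (P.Ψ w) := by
    refine hΨtend.eventually (hhf'.eventually_nhds.and ?_)
    exact (hh.eventually (by simp)).mono fun x hx => hx.differentiableAt (by simp)
  obtain ⟨r₂, hr₂, hball⟩ := Metric.eventually_nhds_iff_ball.1 hev
  obtain ⟨ρ, hρ, hsurj⟩ := P.exists_param_norm_lt
    (r' := min r₁ (min r₂ (δ / (32 * C * P.C)))) (by have := P.C_pos; positivity)
  refine ⟨δ / 64, 4 * C, ρ, by positivity, by positivity, hρ, fun p hp hpρ => ?_⟩
  obtain ⟨w, hwW, hw, hw', rfl⟩ := hsurj p hp hpρ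
  simp only [lt_min_iff] at hw'
  obtain ⟨hwr₁, hwr₂, hwC⟩ := hw'
  obtain ⟨hhfw, hhd⟩ := hball w (by simpa using hwr₂)
  obtain ⟨hb1, hb2⟩ := hbounds w hwW hwr₁
  have hΨd := P.diff w hw
  have hchain : ∀ v, fderiv ℝ (h ∘ P.Ψ) w v = fderiv ℝ h (P.Ψ w) (fderiv ℝ P.Ψ w v) := by
    intro v
    rw [fderiv_comp w hhd hΨd]
    rfl
  have hG := riemannianGrad_eq hp hhd (eventually_nhdsWithin_iff.2 hhfw)
  set G := riemannianGrad f M (P.Ψ w) with hGdef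
  have hT := P.tangent w hwW hw
  have hGT : G ∈ tangentSpaceAt M (P.Ψ w) := by
    rw [hG]
    exact Submodule.starProjection_apply_mem _ _
  have hinner : ∀ v ∈ P.W, inner ℝ G (fderiv ℝ P.Ψ w v) = fderiv ℝ (h ∘ P.Ψ) w v := by
    intro v hv
    have hmem : fderiv ℝ P.Ψ w v ∈ tangentSpaceAt M (P.Ψ w) := by
      rw [hT]
      exact ⟨v, hv, rfl⟩
    rw [hG, hchain, ← inner_gradient, Submodule.inner_starProjection_left_eq_right,
      Submodule.starProjection_eq_self_iff.2 hmem]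
  obtain ⟨v, hv, hvG⟩ : ∃ v ∈ P.W, fderiv ℝ P.Ψ w v = G := by
    rw [hT] at hGT
    exact hGT
  have hnorm0 := P.norm_sub_le 0 w hzero hw
  have hnorm1 := P.norm_map_sub_le 0 w hzero hw
  rw [sub_zero, P.map_zero] at hnorm0 hnorm1
  have hGw : ‖G‖ ≤ 2 * C * ‖w‖ := by
    rcases (norm_nonneg G).eq_or_lt with h0 | h0
    · rw [← h0]; positivity
    have h1 : ‖G‖ ^ 2 ≤ C * ‖w‖ * ‖v‖ := by
      rw [← real_inner_self_eq_norm_sq]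
      nth_rewrite 2 [← hvG]
      rw [hinner v hv]
      exact hb1 v hv
    have h2 : ‖v‖ ≤ 2 * ‖G‖ := hvG ▸ P.norm_le_fderiv w v hw
    have h3 : C * ‖w‖ * ‖v‖ ≤ C * ‖w‖ * (2 * ‖G‖) := by gcongr
    nlinarith
  refine ⟨?_, ?_, ?_⟩
  · nlinarith
  · have hexp := P.expand w 0 hw hzero
    rw [P.map_zero, zero_sub, map_neg, norm_neg] at hexp
    set R := xbar - P.Ψ w - -fderiv ℝ P.Ψ w w with hR
    have h1 : P.Ψ w - xbar = fderiv ℝ P.Ψ w w - R := by rw [hR]; abel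
    have h2 : inner ℝ G R ≤ δ / 16 * ‖w‖ ^ 2 := by
      rw [lt_div_iff₀ (by have := P.C_pos; positivity)] at hwC
      calc inner ℝ G R ≤ ‖G‖ * ‖R‖ := real_inner_le_norm _ _
        _ ≤ (2 * C * ‖w‖) * (P.C * ‖w‖ ^ 2) := by gcongr
        _ = (‖w‖ * (32 * C * P.C)) / 16 * ‖w‖ ^ 2 := by ring
        _ ≤ δ / 16 * ‖w‖ ^ 2 := by gcongr
    have h4 : ‖P.Ψ w - xbar‖ ^ 2 ≤ (2 * ‖w‖) ^ 2 := by gcongr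
    rw [h1, inner_sub_right, hinner w hwW, ← h1]
    nlinarith
  · intro u hu
    have h2 : HasDerivAt (fun t : ℝ => w + t • v) v 0 := by
      simpa using ((hasDerivAt_id (0 : ℝ)).smul_const v).const_add w
    have h3 : HasFDerivAt P.Ψ (fderiv ℝ P.Ψ w) (w + (0 : ℝ) • v) := by
      simpa using hΨd.hasFDerivAt
    have hγ : HasDerivAt (fun t : ℝ => P.Ψ (w + t • v)) G 0 := by
      have := h3.comp_hasDerivAt (0 : ℝ) h2
      rwa [hvG] at this
    have hγ0 : P.Ψ (w + (0 : ℝ) • v) = P.Ψ w := by simp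
    have hγt : Tendsto (fun t : ℝ => P.Ψ (w + t • v)) (𝓝 0) (𝓝 (P.Ψ w)) := by
      simpa using hγ.continuousAt.tendsto
    have hct : Tendsto (fun t : ℝ => w + t • v) (𝓝 0) (𝓝 w) := by
      simpa using h2.continuousAt.tendsto
    have h5 : HasDerivAt (h ∘ fun t : ℝ => P.Ψ (w + t • v)) (fderiv ℝ h (P.Ψ w) G) 0 := by
      have h6 : HasFDerivAt h (fderiv ℝ h (P.Ψ w)) (P.Ψ (w + (0 : ℝ) • v)) := by
        rw [hγ0]
        exact hhd.hasFDerivAt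
      exact h6.comp_hasDerivAt (0 : ℝ) hγ
    have h6 : HasDerivAt (f ∘ fun t : ℝ => P.Ψ (w + t • v)) (fderiv ℝ h (P.Ψ w) G) 0 := by
      refine h5.congr_of_eventuallyEq ?_
      filter_upwards [hγt.eventually hhfw, hct.norm.eventually_lt_const hw] with t ht1 ht2
      exact (ht1 (P.mem _ (P.W.add_mem hwW (P.W.smul_mem t hv)) ht2)).symm
    have h7 := inner_eq_of_regular hf (hreg _ hp) hγ hγ0 h6 hu
    have h8 : fderiv ℝ h (P.Ψ w) G = ‖G‖ ^ 2 := by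
      rw [← real_inner_self_eq_norm_sq]
      nth_rewrite 3 [← hvG]
      rw [hinner v hv, hchain, hvG]
    rw [h8] at h7
    have h9 := real_inner_le_norm u G
    rw [h7, sq] at h9
    rcases (norm_nonneg G).eq_or_lt with h0 | h0
    · rw [← h0]; positivity
    · exact le_of_mul_le_mul_right h9 h0

end Geometry

/-! ### Nearly linear convergence from two kinds of linear progress -/

/-- Two quantities with `φ` antitone and `D ^ 2 ≲ φ ≲ D` such that in each step one of them
contracts by the factor `q`.  Cut the first `n ^ 2` steps into `n` blocks of length `n`.  Either
`φ` contracts at least once in each block, or in some block only `D` contracts, so that `D` and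
with it `φ` is of order `q ^ n` at its end.  In both cases `φ` is of order `q ^ n` after `n ^ 2`
steps. -/
theorem forall_le_mul_pow {D φ : ℕ → ℝ} {b q : ℝ} (hq0 : 0 < q)
    (hb : 0 < b) (hD : ∀ k, 0 ≤ D k) (hφ : ∀ k, 0 ≤ φ k) (hanti : Antitone φ)
    {R : ℝ} (hR : ∀ k, D k ≤ R) (hup : ∀ k, φ k ≤ b * D k)
    (hstep : ∀ k, D (k + 1) ≤ q * D k ∨ φ (k + 1) ≤ q * φ k) :
    ∀ n : ℕ, φ (n ^ 2) ≤ (φ 0 + b * R) * q ^ n := by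
  intro n
  have hR0 : 0 ≤ R := (hD 0).trans (hR 0)
  by_cases hblock : ∃ j < n, ∀ i < n, D (j * n + i + 1) ≤ q * D (j * n + i)
  · obtain ⟨j, hj, hall⟩ := hblock
    have h1 : ∀ i ≤ n, D (j * n + i) ≤ q ^ i * D (j * n) := by
      intro i
      induction i with
      | zero => simp
      | succ i ih =>
        intro hi
        calc D (j * n + i + 1) ≤ q * D (j * n + i) := hall i hi
          _ ≤ q * (q ^ i * D (j * n)) := by gcongr; exact ih (Nat.le_of_succ_le hi)
          _ = q ^ (i + 1) * D (j * n) := by ring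
    have h2 : j * n + n ≤ n ^ 2 := by nlinarith
    calc φ (n ^ 2) ≤ φ (j * n + n) := hanti h2
      _ ≤ b * D (j * n + n) := hup _
      _ ≤ b * (q ^ n * R) := by
        gcongr
        exact (h1 n le_rfl).trans (by gcongr; exact hR _)
      _ ≤ (φ 0 + b * R) * q ^ n := by
        have : 0 ≤ φ 0 * q ^ n := mul_nonneg (hφ 0) (by positivity)
        nlinarith
  · push Not at hblock
    have h1 : ∀ j ≤ n, φ (j * n) ≤ q ^ j * φ 0 := by
      intro j
      induction j with
      | zero => simp
      | succ j ih =>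
        intro hj
        obtain ⟨i, hi, hlt⟩ := hblock j hj
        have h2 : φ (j * n + i + 1) ≤ q * φ (j * n + i) := (hstep _).resolve_left hlt.not_ge
        calc φ ((j + 1) * n) ≤ φ (j * n + i + 1) := hanti (by nlinarith)
          _ ≤ q * φ (j * n + i) := h2
          _ ≤ q * φ (j * n) := by gcongr; exact hanti (Nat.le_add_right _ _)
          _ ≤ q * (q ^ j * φ 0) := by gcongr; exact ih (Nat.le_of_succ_le hj)
          _ = q ^ (j + 1) * φ 0 := by ring
    have h2 := h1 n le_rfl
    rw [← sq] at h2
    have : 0 ≤ b * R * q ^ n := by positivity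
    nlinarith

theorem exists_le_mul_exp_neg_sqrt {D φ : ℕ → ℝ} {a b q : ℝ} (hq0 : 0 < q) (hq1 : q < 1)
    (ha : 0 < a) (hb : 0 < b) (hD : ∀ k, 0 ≤ D k) (hanti : Antitone φ)
    {R : ℝ} (hR : ∀ k, D k ≤ R) (hlow : ∀ k, a * D k ^ 2 ≤ φ k) (hup : ∀ k, φ k ≤ b * D k)
    (hstep : ∀ k, D (k + 1) ≤ q * D k ∨ φ (k + 1) ≤ q * φ k) :
    ∃ A B : ℝ, 0 < A ∧ 0 < B ∧ ∀ k : ℕ, D k ≤ A * Real.exp (-B * √(k : ℝ)) := by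
  have hφ : ∀ k, 0 ≤ φ k := fun k => le_trans (by positivity) (hlow k)
  have hR0 : 0 ≤ R := (hD 0).trans (hR 0)
  have key := forall_le_mul_pow hq0 hb hD hφ hanti hR hup hstep
  set l := -Real.log q with hl
  have hl0 : 0 < l := by
    rw [hl, neg_pos]
    exact Real.log_neg hq0 hq1
  set c := φ 0 + b * R with hc
  have hc0 : 0 ≤ c := add_nonneg (hφ 0) (by positivity)
  refine ⟨√((c + 1) / a * Real.exp l), l / 2, by positivity, by positivity, fun k => ?_⟩
  have hn1 : φ k ≤ c * q ^ (Nat.sqrt k) :=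
    (hanti (Nat.sqrt_le' k)).trans (key (Nat.sqrt k))
  have hqe : q ^ (Nat.sqrt k) = Real.exp (-l * Nat.sqrt k) := by
    rw [hl, neg_neg, mul_comm, Real.exp_nat_mul, Real.exp_log hq0]
  have hsq : √(k : ℝ) ≤ Nat.sqrt k + 1 := Real.real_sqrt_le_nat_sqrt_succ
  have h1 : a * D k ^ 2 ≤ (c + 1) * (Real.exp l * Real.exp (-l * √(k : ℝ))) := by
    calc a * D k ^ 2 ≤ c * q ^ (Nat.sqrt k) := (hlow k).trans hn1
      _ ≤ (c + 1) * (Real.exp l * Real.exp (-l * √(k : ℝ))) := by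
        rw [hqe, ← Real.exp_add]
        gcongr
        · linarith
        · nlinarith
  have h2 : Real.exp (-l * √(k : ℝ)) = Real.exp (-(l / 2) * √(k : ℝ)) ^ 2 := by
    rw [← Real.exp_nat_mul]
    congr 1
    push_cast
    ring
  rw [h2] at h1
  refine le_of_sq_le_sq ?_ (by positivity)
  rw [mul_pow, Real.sq_sqrt (by positivity), div_mul_eq_mul_div, div_mul_eq_mul_div,
    le_div_iff₀ ha]
  linarith

/-! ### Goldstein subgradients near the manifold -/

section Iteration

open scoped Pointwise

variable {X : Type*} [NormedAddCommGroup X] [InnerProductSpace ℝ X] [FiniteDimensional ℝ X]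
variable {f : X → ℝ} {M : Set X} {xbar : X}

/-- If the distance to `M` is large relative to the radius, then the aiming condition gives all
subgradients at points of the ball a definite component along `x - P_M(x)`, by the Lipschitz
continuity of `P_M`.  So a short Goldstein subgradient certifies that `x` is close to `M`. -/
theorem exists_norm_sub_nearestPoint_le (hf : LocallyLipschitz f)
    (hM : IsC2ManifoldAround M xbar) (haim : AimingCondition f M xbar) :
    ∃ m C r : ℝ, 0 < m ∧ 0 < C ∧ 0 < r ∧ ∀ x s, ‖x - xbar‖ < r → 0 ≤ s → s < r →
      ‖goldsteinSubgrad f s x‖ < m → ‖x - nearestPoint M x‖ ≤ C * s := by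
  obtain ⟨μ, hμ, haim⟩ := haim
  obtain ⟨r₁, hr₁, haim⟩ := Metric.eventually_nhds_iff_ball.1 haim
  obtain ⟨r₂, hr₂, hnear, hlip⟩ := hM.exists_nearestPoint_lipschitz
  obtain ⟨K, t, ht, hK⟩ := hf xbar
  obtain ⟨r₃, hr₃, hball⟩ := Metric.eventually_nhds_iff_ball.1 (eventually_mem_nhds_iff.2 ht)
  refine ⟨μ / 2, 2 * (μ + 3 * K) / μ, min r₁ (min r₂ r₃) / 2, by positivity, by positivity,
    by positivity, fun x s hx hs hsr hg => ?_⟩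
  by_contra hlt
  push Not at hlt
  set p := nearestPoint M x with hp
  have hr : ∀ y ∈ closedBall x s, ‖y - xbar‖ < min r₁ (min r₂ r₃) := by
    intro y hy
    rw [mem_closedBall_iff_norm] at hy
    have := norm_sub_le_norm_sub_add_norm_sub y x xbar
    linarith
  have hx2 : ‖x - xbar‖ < r₂ := (lt_min_iff.1 (lt_min_iff.1 (hr x (mem_closedBall_self hs))).2).1
  have hpos : 0 < ‖x - p‖ := lt_of_le_of_lt (by positivity) hlt
  rw [div_mul_eq_mul_div, div_lt_iff₀ hμ] at hlt
  have hall : ∀ v ∈ ⋃ y ∈ closedBall x s, clarkeSubdiff f y,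
      μ / 2 * ‖x - p‖ ≤ inner ℝ v (x - p) := by
    intro v hv
    simp only [Set.mem_iUnion] at hv
    obtain ⟨y, hy, hv⟩ := hv
    have hyr := hr y hy
    simp only [lt_min_iff] at hyr
    have hys : ‖y - x‖ ≤ s := mem_closedBall_iff_norm.1 hy
    have h1 := haim y (mem_ball_iff_norm.2 hyr.1) v hv
    have h2 : infDist x M ≤ infDist y M + ‖y - x‖ := by
      rw [norm_sub_rev, ← dist_eq_norm]
      exact infDist_le_infDist_add_dist
    rw [(hnear x hx2).2.1] at h2
    have h3 := hlip x y hx2 hyr.2.1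
    have h4 : ‖v‖ ≤ K := norm_le_of_mem_clarkeSubdiff (hball y (mem_ball_iff_norm.2 hyr.2.2)) hK hv
    set q := nearestPoint M y with hq
    have h5 : x - p = (y - q) - ((y - x) - (q - p)) := by abel
    have h6 : inner ℝ v ((y - x) - (q - p)) ≤ K * (3 * s) := by
      calc inner ℝ v ((y - x) - (q - p)) ≤ ‖v‖ * ‖(y - x) - (q - p)‖ := real_inner_le_norm _ _
        _ ≤ K * (3 * s) := by
          gcongr
          exact (norm_sub_le _ _).trans (by linarith)
    have h7 : inner ℝ v (x - p) = inner ℝ v (y - q) - inner ℝ v ((y - x) - (q - p)) := by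
      rw [← inner_sub_right, ← h5]
    have h8 : μ * (‖x - p‖ - s) ≤ μ * infDist y M := by gcongr; linarith
    rw [h7]
    linarith
  have h1 := le_inner_of_mem_closure_convexHull hall
    (subset_closure (goldsteinSubgrad_mem hf hs x))
  have h2 := real_inner_le_norm (goldsteinSubgrad f s x) (x - p)
  exact hg.not_ge (le_of_mul_le_mul_right (h1.trans h2) hpos)

/-- The Goldstein modulus `inf {ε | ‖g_ε(x)‖ ≤ ε}` is at least of the order of `‖x - xbar‖`.  If
`‖g_ε(x)‖ ≤ ε`, then `x` is within `O(ε)` of `M`, and `g_ε(x)` is within `O(ε)` of a subgradient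
at `p = P_M(x)`.  This one is no shorter than the Riemannian gradient, which is of order
`‖p - xbar‖`; hence `‖x - xbar‖ = O(ε)`. -/
theorem exists_lt_norm_goldsteinSubgrad (hf : LocallyLipschitz f)
    (hM : IsC2ManifoldAround M xbar) (hrob : GrowsRobustly f M xbar) :
    ∃ c r : ℝ, 0 < c ∧ 0 < r ∧ ∀ x ε, x ≠ xbar → ‖x - xbar‖ < r → 0 ≤ ε →
      ε ≤ c * ‖x - xbar‖ → ε < ‖goldsteinSubgrad f ε x‖ := by
  obtain ⟨m, C, r₁, hm, hC, hr₁, hclose⟩ := exists_norm_sub_nearestPoint_le hf hM hrob.aiming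
  obtain ⟨κ, CG, r₂, hκ, hCG, hr₂, hG⟩ :=
    exists_riemannianGrad_bounds hf hM hrob.quadratic hrob.regular hrob.smooth
  obtain ⟨K, hK, r₃, hr₃, hup⟩ := hrob.upperLipschitz
  obtain ⟨r₄, hr₄, hnear, -⟩ := hM.exists_nearestPoint_lipschitz
  set C₂ := C + (1 + K * (C + 1)) / κ with hC₂
  have hC₂0 : 0 < C₂ := by positivity
  refine ⟨min 1 (1 / (2 * C₂)), min r₁ (min (r₂ / 2) (min (r₃ / 2) (min r₄ m))), by positivity,
    by positivity, fun x ε hne hx hε hεc => ?_⟩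
  simp only [lt_min_iff] at hx
  obtain ⟨hx1, hx2, hx3, hx4, hxm⟩ := hx
  have hD : 0 < ‖x - xbar‖ := norm_pos_iff.2 (sub_ne_zero.2 hne)
  have hε1 : ε ≤ ‖x - xbar‖ := hεc.trans (mul_le_of_le_one_left hD.le (min_le_left _ _))
  by_contra hg
  push Not at hg
  have hd := hclose x ε hx1 hε (by linarith) (by linarith)
  obtain ⟨hpM, -, hpD⟩ := hnear x hx4
  set p := nearestPoint M x with hp
  have hpx : ‖p - xbar‖ ≤ 2 * ‖x - xbar‖ := by
    have := norm_sub_le_norm_sub_add_norm_sub p x xbar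
    rw [norm_sub_rev p x] at this
    linarith
  obtain ⟨-, hGlow, hGv⟩ := hG p hpM (by linarith)
  -- the vectors close to `∂f(p)` form a convex set that contains the Goldstein subdifferential
  have hsub : goldsteinSubdiff f ε x ⊆
      clarkeSubdiff f p + closedBall (0 : X) (K * (C + 1) * ε) := by
    refine convexHull_min ?_ ((convex_clarkeSubdiff p).add (convex_closedBall _ _))
    refine Set.iUnion₂_subset fun y hy v hv => ?_
    have hyx : ‖y - x‖ ≤ ε := mem_closedBall_iff_norm.1 hy
    have hyb : ‖y - xbar‖ < r₃ := by
      have := norm_sub_le_norm_sub_add_norm_sub y x xbar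
      linarith
    obtain ⟨w, hw, hvw⟩ := hup p ⟨hpM, mem_ball_iff_norm.2 (by linarith)⟩ y
      (mem_ball_iff_norm.2 hyb) v hv
    refine ⟨w, hw, v - w, ?_, add_sub_cancel w v⟩
    rw [mem_closedBall_zero_iff]
    refine hvw.trans ?_
    rw [mul_assoc]
    gcongr
    have := norm_sub_le_norm_sub_add_norm_sub p x y
    rw [norm_sub_rev p x, norm_sub_rev x y] at this
    linarith
  obtain ⟨w, hw, e, he, hwe⟩ := hsub (goldsteinSubgrad_mem hf hε x)
  change w + e = goldsteinSubgrad f ε x at hwe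
  rw [mem_closedBall_zero_iff] at he
  have hwn : ‖w‖ ≤ (1 + K * (C + 1)) * ε := by
    have h1 : w = goldsteinSubgrad f ε x - e := by rw [← hwe]; abel
    rw [h1]
    exact (norm_sub_le _ _).trans (by linarith)
  have hpn : ‖p - xbar‖ ≤ (1 + K * (C + 1)) * ε / κ := by
    rw [le_div_iff₀ hκ]
    have h1 := hGlow.trans (real_inner_le_norm _ _)
    have h2 : ‖riemannianGrad f M p‖ ≤ (1 + K * (C + 1)) * ε := (hGv w hw).trans hwn
    rcases (norm_nonneg (p - xbar)).eq_or_lt with h0 | h0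
    · rw [← h0, zero_mul]; positivity
    · have h3 : κ * ‖p - xbar‖ * ‖p - xbar‖ ≤ (1 + K * (C + 1)) * ε * ‖p - xbar‖ := by
        calc κ * ‖p - xbar‖ * ‖p - xbar‖ = κ * ‖p - xbar‖ ^ 2 := by ring
          _ ≤ _ := h1
          _ ≤ _ := by gcongr
      linarith [le_of_mul_le_mul_right h3 h0]
  have h1 : ‖x - xbar‖ ≤ C₂ * ε := by
    have h2 := norm_sub_le_norm_sub_add_norm_sub x p xbar
    have h3 : C₂ * ε = C * ε + (1 + K * (C + 1)) * ε / κ := by rw [hC₂]; ring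
    linarith
  have h2 : ε ≤ 1 / (2 * C₂) * ‖x - xbar‖ := hεc.trans (by gcongr; exact min_le_right _ _)
  rw [div_mul_eq_mul_div, one_mul, le_div_iff₀ (by positivity)] at h2
  linarith

theorem zero_mem_clarkeSubdiff (hf : LocallyLipschitz f) (hquad : GrowsQuadratically f xbar)
    (hreg : SubdiffRegularAt f xbar) : (0 : X) ∈ clarkeSubdiff f xbar := by
  obtain ⟨hg, hmin⟩ := shortest_spec (isCompact_clarkeSubdiff hf xbar)
    (nonempty_clarkeSubdiff hf xbar)
  set g := shortest (clarkeSubdiff f xbar) with hgdef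
  obtain ⟨δ, hδ, hgrow⟩ := hquad
  -- the directional derivatives at the minimizer `xbar` are nonnegative
  have h1 : 0 ≤ clarkeDirDeriv f xbar (-g) := by
    refine ge_of_tendsto (hreg (-g)) ?_
    have h2 : Tendsto (fun t : ℝ => xbar + t • (-g)) (𝓝 0) (𝓝 xbar) := by
      have : Continuous fun t : ℝ => xbar + t • (-g) := by fun_prop
      simpa using this.tendsto 0
    filter_upwards [nhdsWithin_le_nhds (h2.eventually hgrow), self_mem_nhdsWithin] with t ht ht0
    have ht0' : (0 : ℝ) < t := ht0
    have : 0 ≤ f (xbar + t • (-g)) - f xbar := le_trans (by positivity) ht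
    positivity
  have h2 : clarkeDirDeriv f xbar (-g) ≤ -‖g‖ ^ 2 := by
    refine csSup_le ((nonempty_clarkeSubdiff hf xbar).image _) ?_
    rintro _ ⟨v, hv, rfl⟩
    have := sq_norm_le_inner_of_shortest (convex_clarkeSubdiff xbar) hg hmin hv
    simp only [inner_neg_right]
    linarith
  have h3 : g = 0 := by
    have : ‖g‖ ^ 2 ≤ 0 := by linarith
    simpa using this
  rwa [h3] at hg

theorem goldsteinSubgrad_eq_zero (hf : LocallyLipschitz f) (h0 : (0 : X) ∈ clarkeSubdiff f xbar)
    {x : X} {ε : ℝ} (h : ‖x - xbar‖ ≤ ε) : goldsteinSubgrad f ε x = 0 := by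
  have hmem : xbar ∈ closedBall x ε := by rwa [mem_closedBall', dist_eq_norm]
  have := norm_goldsteinSubgrad_le hf ((norm_nonneg _).trans h)
    (clarkeSubdiff_subset_goldsteinSubdiff hmem h0)
  simpa using this

/-! ### One iteration -/

/-- The uniform form of tempered growth. -/
theorem TemperedGrowth.exists_uniform (h : TemperedGrowth f M xbar) {θ : ℝ} (hθ : 0 < θ) :
    ∃ β₀ : ℝ, 0 < β₀ ∧ ∀ β : ℝ, 0 < β → β ≤ β₀ → ∃ η : ℝ, 0 < η ∧
      ∀ x ε, x ≠ xbar → ‖x - xbar‖ < η → 0 ≤ ε → ε ≤ β * ‖x - xbar‖ →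
        ‖goldsteinSubgrad f ε x‖ ≤ η → goldsteinSubgrad f ε x ≠ 0 ∧
          riemannianGrad f M (nearestPoint M x) ≠ 0 ∧
          InnerProductGeometry.angle (goldsteinSubgrad f ε x)
            (riemannianGrad f M (nearestPoint M x)) < θ := by
  obtain ⟨β₀, hβ₀, hseq⟩ := h θ hθ
  refine ⟨β₀, hβ₀, fun β hβ hββ₀ => ?_⟩
  by_contra hcon
  push Not at hcon
  have hlim : Tendsto (fun n : ℕ => 1 / ((n : ℝ) + 1)) atTop (𝓝 0) :=
    tendsto_one_div_add_atTop_nhds_zero_nat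
  choose x ε hne hx hε hεβ hg hbad using fun n : ℕ =>
    hcon (1 / ((n : ℝ) + 1)) Nat.one_div_pos_of_nat
  have hxlim : Tendsto x atTop (𝓝 xbar) := by
    rw [tendsto_iff_norm_sub_tendsto_zero]
    exact squeeze_zero (fun _ => norm_nonneg _) (fun n => (hx n).le) hlim
  have hglim : Tendsto (fun n => goldsteinSubgrad f (ε n) (x n)) atTop (𝓝 0) :=
    squeeze_zero_norm hg hlim
  obtain ⟨n, h1, h2, h3⟩ :=
    (hseq β hβ hββ₀ x ε hne hxlim (fun n => ⟨hε n, hεβ n⟩) hglim).exists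
  exact (hbad n h1 h2).not_gt h3

/-- The bisection loop returns a radius that is a lower bound for the Goldstein modulus and of
at least the order of the bound `c`. -/
theorem exists_bisection_eq_some {L c : ℝ} {x : X} (hL : 0 < L) (hc : 0 < c) (hcL : c ≤ L)
    (h : ∀ ε, 0 ≤ ε → ε ≤ c → ε < ‖goldsteinSubgrad f ε x‖) :
    ∃ ε, bisection f L x = some ε ∧ c / 2 ≤ ε ∧ ε < ‖goldsteinSubgrad f ε x‖ := by
  classical
  have hex : ∃ n : ℕ, L / 2 ^ (n + 1) < ‖goldsteinSubgrad f (L / 2 ^ (n + 1)) x‖ := by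
    obtain ⟨n, hn⟩ := exists_nat_gt (L / c)
    refine ⟨n, h _ (by positivity) ?_⟩
    have h1 : (n : ℝ) < 2 ^ n := by exact_mod_cast Nat.lt_two_pow_self
    rw [div_lt_iff₀ hc] at hn
    rw [div_le_iff₀ (by positivity), pow_succ]
    nlinarith
  refine ⟨L / 2 ^ (Nat.find hex + 1), by rw [bisection, dif_pos hex], ?_, Nat.find_spec hex⟩
  rcases hk : Nat.find hex with _ | k
  · simp only [zero_add, pow_one]
    linarith
  · -- the preceding radius, twice the final one, has failed the test
    have h1 := Nat.find_min hex (m := k) (by omega)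
    have h2 : c < L / 2 ^ (k + 1) := by
      by_contra hle
      exact h1 (h _ (by positivity) (not_lt.1 hle))
    rw [pow_succ 2 (k + 1), ← div_div]
    linarith

theorem norm_normalize_sub_le_of_angle_lt {V : Type*} [NormedAddCommGroup V]
    [InnerProductSpace ℝ V] {g G : V} (hg : g ≠ 0) (hG : G ≠ 0) {θ : ℝ}
    (h : InnerProductGeometry.angle g G < θ) : ‖‖g‖⁻¹ • g - ‖G‖⁻¹ • G‖ ≤ θ := by
  have hg' : 0 < ‖g‖ := norm_pos_iff.2 hg
  have hG' : 0 < ‖G‖ := norm_pos_iff.2 hG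
  have h0 := InnerProductGeometry.angle_nonneg g G
  have h1 : ‖‖g‖⁻¹ • g - ‖G‖⁻¹ • G‖ ^ 2 =
      2 - 2 * Real.cos (InnerProductGeometry.angle g G) := by
    rw [InnerProductGeometry.cos_angle, norm_sub_sq_real, norm_smul, norm_smul,
      real_inner_smul_left, real_inner_smul_right, norm_inv, norm_inv, norm_norm, norm_norm,
      inv_mul_cancel₀ hg'.ne', inv_mul_cancel₀ hG'.ne']
    field_simp
    ring
  have h2 := Real.one_sub_sq_div_two_le_cos (x := InnerProductGeometry.angle g G)
  refine le_of_sq_le_sq ?_ (h0.trans h.le)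
  rw [h1]
  nlinarith

/-- A short step along a unit vector `u` that makes an angle bounded away from `π / 2` with
`z` reduces the length of `z` by a factor. -/
theorem norm_sub_smul_le {V : Type*} [NormedAddCommGroup V] [InnerProductSpace ℝ V]
    {z u : V} {s a b : ℝ} (hu : ‖u‖ = 1) (ha : 0 ≤ a) (hb : 0 ≤ b)
    (hs : b * ‖z‖ ≤ s) (hs' : s ≤ a * ‖z‖) (hin : a * ‖z‖ ≤ inner ℝ u z)
    (hab : a * b ≤ 1) : ‖z - s • u‖ ≤ (1 - a * b / 2) * ‖z‖ := by
  have hs0 : 0 ≤ s := le_trans (by positivity) hs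
  refine le_of_sq_le_sq ?_ (mul_nonneg (by linarith) (norm_nonneg z))
  rw [norm_sub_sq_real, norm_smul, hu, mul_one, Real.norm_eq_abs, sq_abs, real_inner_smul_right,
    real_inner_comm]
  have h1 : s * (a * ‖z‖) ≤ s * inner ℝ u z := by gcongr
  have h2 : s * s ≤ s * (a * ‖z‖) := by gcongr
  have h3 : b * ‖z‖ * (a * ‖z‖) ≤ s * (a * ‖z‖) := by gcongr
  nlinarith [sq_nonneg (a * b * ‖z‖)]

/-- When the Goldstein subgradient is short, the point is close to `M` and the step goes nearly
in the direction of the negative Riemannian gradient, and thus makes an angle bounded away from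
`π / 2` with `xbar - x`. -/
theorem exists_le_inner_of_short_subgrad (hf : LocallyLipschitz f)
    (hM : IsC2ManifoldAround M xbar) (hrob : GrowsRobustly f M xbar)
    (htemp : TemperedGrowth f M xbar) :
    ∃ a β₀ : ℝ, 0 < a ∧ 0 < β₀ ∧ ∀ β : ℝ, 0 < β → β ≤ β₀ → ∃ η r : ℝ, 0 < η ∧ 0 < r ∧
      ∀ x s, x ≠ xbar → ‖x - xbar‖ < r → 0 ≤ s → s ≤ β * ‖x - xbar‖ →
        ‖goldsteinSubgrad f s x‖ ≤ η →
        a * ‖x - xbar‖ ≤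
          inner ℝ (‖goldsteinSubgrad f s x‖⁻¹ • goldsteinSubgrad f s x) (x - xbar) := by
  obtain ⟨m, C, r₁, hm, hC, hr₁, hclose⟩ := exists_norm_sub_nearestPoint_le hf hM hrob.aiming
  obtain ⟨κ, CG, r₂, hκ, hCG, hr₂, hG⟩ :=
    exists_riemannianGrad_bounds hf hM hrob.quadratic hrob.regular hrob.smooth
  obtain ⟨r₄, hr₄, hnear, -⟩ := hM.exists_nearestPoint_lipschitz
  set a := κ / CG with ha
  have ha0 : 0 < a := by positivity
  obtain ⟨β₁, hβ₁, htemp⟩ := htemp.exists_uniform (θ := a / 2) (by positivity)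
  refine ⟨a / 4, min β₁ (min 1 (a / (4 * (1 + a / 2) * C))), by positivity, by positivity, ?_⟩
  intro β hβ hββ₀
  simp only [le_min_iff] at hββ₀
  obtain ⟨hβ1, hβ2, hβ3⟩ := hββ₀
  obtain ⟨η, hη, htemp⟩ := htemp β hβ hβ1
  refine ⟨min η (m / 2), min η (min r₁ (min (r₂ / 2) r₄)), by positivity, by positivity, ?_⟩
  intro x s hne hx hs hsβ hgs
  simp only [lt_min_iff] at hx
  obtain ⟨hxη, hx1, hx2, hx4⟩ := hx
  have hD : 0 < ‖x - xbar‖ := norm_pos_iff.2 (sub_ne_zero.2 hne)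
  obtain ⟨hg0, hG0, hang⟩ := htemp x s hne hxη hs hsβ (hgs.trans (min_le_left _ _))
  have hsD : s ≤ ‖x - xbar‖ := hsβ.trans (mul_le_of_le_one_left hD.le hβ2)
  have hd := hclose x s hx1 hs (by linarith)
    ((hgs.trans (min_le_right _ _)).trans_lt (by linarith))
  obtain ⟨hpM, -, hpD⟩ := hnear x hx4
  set p := nearestPoint M x with hp
  have hpx : ‖p - xbar‖ ≤ 2 * ‖x - xbar‖ := by
    have := norm_sub_le_norm_sub_add_norm_sub p x xbar
    rw [norm_sub_rev p x] at this
    linarith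
  obtain ⟨hGup, hGlow, -⟩ := hG p hpM (by linarith)
  set g := goldsteinSubgrad f s x with hgdef
  set G := riemannianGrad f M p with hGdef
  have hGpos : 0 < ‖G‖ := norm_pos_iff.2 hG0
  have hchord := norm_normalize_sub_le_of_angle_lt hg0 hG0 hang
  set u := ‖g‖⁻¹ • g with hu
  have hun : ‖u‖ = 1 := by
    rw [hu, norm_smul, norm_inv, norm_norm, inv_mul_cancel₀ (norm_ne_zero_iff.2 hg0)]
  have h1 : a * ‖p - xbar‖ ≤ inner ℝ (‖G‖⁻¹ • G) (p - xbar) := by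
    rw [real_inner_smul_left, le_inv_mul_iff₀ hGpos]
    calc ‖G‖ * (a * ‖p - xbar‖) ≤ (CG * ‖p - xbar‖) * (a * ‖p - xbar‖) := by gcongr
      _ = κ * ‖p - xbar‖ ^ 2 := by rw [ha]; field_simp
      _ ≤ _ := hGlow
  have h2 : -(a / 2 * ‖p - xbar‖) ≤ inner ℝ (u - ‖G‖⁻¹ • G) (p - xbar) := by
    have h3 := abs_real_inner_le_norm (u - ‖G‖⁻¹ • G) (p - xbar)
    have h4 : ‖u - ‖G‖⁻¹ • G‖ * ‖p - xbar‖ ≤ a / 2 * ‖p - xbar‖ := by gcongr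
    linarith [(abs_le.1 (h3.trans h4)).1]
  rw [inner_sub_left] at h2
  have h3 : -‖x - p‖ ≤ inner ℝ u (x - p) := by
    have h3 := abs_real_inner_le_norm u (x - p)
    rw [hun, one_mul] at h3
    exact (abs_le.1 h3).1
  have h4 : inner ℝ u (x - xbar) = inner ℝ u (x - p) + inner ℝ u (p - xbar) := by
    rw [← inner_add_right, sub_add_sub_cancel]
  have h5 : ‖x - xbar‖ ≤ ‖x - p‖ + ‖p - xbar‖ := norm_sub_le_norm_sub_add_norm_sub x p xbar
  have h6 : a / 2 * ‖x - xbar‖ ≤ a / 2 * (‖x - p‖ + ‖p - xbar‖) := by gcongr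
  have h7 : (1 + a / 2) * ‖x - p‖ ≤ a / 4 * ‖x - xbar‖ := by
    rw [le_div_iff₀ (by positivity)] at hβ3
    calc (1 + a / 2) * ‖x - p‖ ≤ (1 + a / 2) * (C * (β * ‖x - xbar‖)) := by
          gcongr
          exact hd.trans (by gcongr)
      _ = β * (4 * (1 + a / 2) * C) / 4 * ‖x - xbar‖ := by ring
      _ ≤ a / 4 * ‖x - xbar‖ := by gcongr
  rw [h4]
  linarith

/-- Near `xbar` an iteration can be completed, does not increase `f`, and reduces either the
distance to `xbar` or the excess of `f` over its minimum by a factor: the former if the Goldstein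
subgradient is short, the latter if it is not. -/
theorem exists_fastStep_contraction (hf : LocallyLipschitz f)
    (hM : IsC2ManifoldAround M xbar) (hrob : GrowsRobustly f M xbar)
    (htemp : TemperedGrowth f M xbar) {L : ℝ} (hL : 0 < L) :
    ∃ β₀ : ℝ, 0 < β₀ ∧ ∀ β : ℝ, 0 < β → β ≤ β₀ → ∃ q r : ℝ, 0 < q ∧ q < 1 ∧ 0 < r ∧
      ∀ x, x ≠ xbar → ‖x - xbar‖ < r → ∃ x', fastStep f L β x = some x' ∧ f x' ≤ f x ∧
        ‖x' - xbar‖ ≤ 2 * ‖x - xbar‖ ∧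
        (‖x' - xbar‖ ≤ q * ‖x - xbar‖ ∨ f x' - f xbar ≤ q * (f x - f xbar)) := by
  obtain ⟨c, r₁, hc, hr₁, hmod⟩ := exists_lt_norm_goldsteinSubgrad hf hM hrob
  obtain ⟨a, β₁, ha, hβ₁, hshort⟩ := exists_le_inner_of_short_subgrad hf hM hrob htemp
  have hzero := zero_mem_clarkeSubdiff hf hrob.quadratic (hrob.regular xbar hM.1)
  obtain ⟨K, t, ht, hK⟩ := hf xbar
  obtain ⟨r₂, hr₂, hball⟩ := Metric.mem_nhds_iff.1 ht
  obtain ⟨δ, hδ, hgrow⟩ := hrob.quadratic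
  obtain ⟨r₄, hr₄, hgrow⟩ := Metric.eventually_nhds_iff_ball.1 hgrow
  refine ⟨min β₁ (min 1 a), by positivity, fun β hβ hββ₀ => ?_⟩
  simp only [le_min_iff] at hββ₀
  obtain ⟨hβ1, hβ2, hβa⟩ := hββ₀
  obtain ⟨η, r₃, hη, hr₃, hshort⟩ := hshort β hβ hβ1
  set b := β * c / 2 with hb
  have hb0 : 0 < b := by positivity
  set q := max (1 / 2) (max (1 - a * b / 2) (1 - b * η / (K + 1))) with hq
  have hK1 : (0 : ℝ) < K + 1 := by positivity
  refine ⟨q, min r₁ (min r₂ (min r₃ (min r₄ (L / c)))), by positivity, ?_, by positivity, ?_⟩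
  · refine max_lt (by norm_num) (max_lt ?_ ?_)
    · have : 0 < a * b := by positivity
      linarith
    · have : 0 < b * η / (K + 1) := by positivity
      linarith
  intro x hne hx
  simp only [lt_min_iff] at hx
  obtain ⟨hx1, hx2, hx3, hx4, hxL⟩ := hx
  have hD : 0 < ‖x - xbar‖ := norm_pos_iff.2 (sub_ne_zero.2 hne)
  rw [lt_div_iff₀ hc] at hxL
  obtain ⟨ε, hbis, hεlow, hεg⟩ := exists_bisection_eq_some (c := c * ‖x - xbar‖) hL
    (by positivity) (by linarith) fun ε hε hεc => hmod x ε hne hx1 hε hεc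
  have hε0 : 0 < ε := lt_of_lt_of_le (by positivity) hεlow
  have hεD : ε < ‖x - xbar‖ := by
    by_contra hle
    rw [goldsteinSubgrad_eq_zero hf hzero (not_lt.1 hle), norm_zero] at hεg
    linarith
  set s := β * ε with hs
  have hs0 : 0 < s := by positivity
  have hsε : s ≤ ε := mul_le_of_le_one_left hε0.le hβ2
  set g := goldsteinSubgrad f s x with hg
  have hgε : ε < ‖g‖ := hεg.trans_le (norm_goldsteinSubgrad_anti hf hs0.le hsε x)
  have hg0 : g ≠ 0 := norm_pos_iff.1 (hε0.trans hgε)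
  have hsb : b * ‖x - xbar‖ ≤ s := by
    calc b * ‖x - xbar‖ = β * (c * ‖x - xbar‖ / 2) := by rw [hb]; ring
      _ ≤ s := by rw [hs]; gcongr
  have hsβ : s ≤ β * ‖x - xbar‖ := by rw [hs]; gcongr
  have hdesc := apply_goldstein_step_le hf hs0.le x
  rw [← hg] at hdesc
  have hstepeq : x - (s / ‖g‖) • g - xbar = (x - xbar) - s • (‖g‖⁻¹ • g) := by
    rw [smul_smul, div_eq_mul_inv]
    abel
  have hun : ‖‖g‖⁻¹ • g‖ = 1 := by
    rw [norm_smul, norm_inv, norm_norm, inv_mul_cancel₀ (norm_ne_zero_iff.2 hg0)]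
  refine ⟨x - (s / ‖g‖) • g, ?_, ?_, ?_, ?_⟩
  · simp only [fastStep, hbis, Option.bind_some]
    exact if_neg hg0
  · have : 0 ≤ s * ‖g‖ := by positivity
    linarith
  · rw [hstepeq]
    refine (norm_sub_le _ _).trans ?_
    rw [norm_smul, hun, mul_one, Real.norm_of_nonneg hs0.le]
    linarith
  · rcases le_or_gt ‖g‖ η with hgη | hgη
    · left
      have hin := hshort x s hne hx3 hs0.le hsβ hgη
      have hsa : s ≤ a * ‖x - xbar‖ := hsβ.trans (by gcongr)
      have hab : a * b ≤ 1 := by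
        -- `a ≤ 1` and `b ≤ 1`, since `a ‖z‖ ≤ ⟪u, z⟫ ≤ ‖z‖` and `b ‖z‖ ≤ s ≤ ‖z‖`
        have h1 : a * ‖x - xbar‖ ≤ 1 * ‖x - xbar‖ := by
          refine hin.trans ((real_inner_le_norm _ _).trans ?_)
          rw [hun]
        have h2 : b * ‖x - xbar‖ ≤ 1 * ‖x - xbar‖ := by linarith
        exact mul_le_one₀ (le_of_mul_le_mul_right h1 hD) hb0.le (le_of_mul_le_mul_right h2 hD)
      rw [hstepeq]
      refine (norm_sub_smul_le hun ha.le hb0.le hsb hsa hin hab).trans ?_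
      gcongr
      exact (le_max_left _ _).trans (le_max_right _ _)
    · right
      have h1 : f x - f xbar ≤ (K + 1) * ‖x - xbar‖ := by
        have h2 := hK.norm_sub_le (hball (mem_ball_iff_norm.2 hx2)) (mem_of_mem_nhds ht)
        rw [Real.norm_eq_abs] at h2
        linarith [le_abs_self (f x - f xbar)]
      have h2 : b * ‖x - xbar‖ * η ≤ s * ‖g‖ := by gcongr
      have h3 : b * η / (K + 1) * (f x - f xbar) ≤ b * ‖x - xbar‖ * η := by
        calc b * η / (K + 1) * (f x - f xbar)
            ≤ b * η / (K + 1) * ((K + 1) * ‖x - xbar‖) := by gcongr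
          _ = b * ‖x - xbar‖ * η := by field_simp
      have h4 : 0 ≤ f x - f xbar :=
        le_trans (by positivity) (hgrow x (mem_ball_iff_norm.2 hx4))
      calc f (x - (s / ‖g‖) • g) - f xbar
          ≤ (1 - b * η / (K + 1)) * (f x - f xbar) := by linarith
        _ ≤ q * (f x - f xbar) := by
          gcongr
          exact (le_max_right _ _).trans (le_max_right _ _)

theorem fastIterate_succ_of_eq (hf : LocallyLipschitz f) (h0 : (0 : X) ∈ clarkeSubdiff f xbar)
    {L β : ℝ} (hL : 0 < L) {x₀ : X} {k : ℕ} (hk : fastIterate f L β x₀ k = xbar) :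
    fastIterate f L β x₀ (k + 1) = xbar := by
  have hnone : bisection f L xbar = none := by
    refine dif_neg ?_
    rintro ⟨n, hn⟩
    have hpos : 0 < L / 2 ^ (n + 1) := by positivity
    rw [goldsteinSubgrad_eq_zero hf h0 (by simpa using hpos.le), norm_zero] at hn
    linarith
  rw [fastIterate, hk, fastStep, hnone]
  rfl

end Iteration

end Goldstein

open Goldstein
theorem mainTheorem3 {X : Type*} [NormedAddCommGroup X] [InnerProductSpace ℝ X]
    [FiniteDimensional ℝ X] (f : X → ℝ) (M : Set X) (xbar : X) (L : ℝ)
    (hf : LocallyLipschitz f) (hM : IsC2ManifoldAround M xbar)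
    (hrobust : GrowsRobustly f M xbar) (htempered : TemperedGrowth f M xbar) (hL : 0 < L) :
    ∃ β₀ : ℝ, 0 < β₀ ∧ ∀ β : ℝ, 0 < β → β ≤ β₀ →
      ∃ ρ : ℝ, 0 < ρ ∧ ∀ x₀ : X, ‖x₀ - xbar‖ < ρ →
        (∀ k : ℕ, fastIterate f L β x₀ k ≠ xbar →
          ∃ x', fastStep f L β (fastIterate f L β x₀ k) = some x') ∧
        ConvergesNearlyLinearly (fastIterate f L β x₀) xbar := by
  obtain ⟨β₀, hβ₀, hstep⟩ := exists_fastStep_contraction hf hM hrobust htempered hL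
  refine ⟨β₀, hβ₀, fun β hβ hββ₀ => ?_⟩
  obtain ⟨q, r₁, hq0, hq1, hr₁, hstep⟩ := hstep β hβ hββ₀
  have hzero := zero_mem_clarkeSubdiff hf hrobust.quadratic (hrobust.regular xbar hM.1)
  obtain ⟨δ, hδ, hgrow⟩ := hrobust.quadratic
  obtain ⟨r₂, hr₂, hgrow⟩ := Metric.eventually_nhds_iff_ball.1 hgrow
  obtain ⟨K, t, ht, hK⟩ := hf xbar
  obtain ⟨r₃, hr₃, hball⟩ := Metric.mem_nhds_iff.1 ht
  set r := min r₁ (min r₂ r₃) with hr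
  have hr0 : 0 < r := by positivity
  have hup : ∀ x, ‖x - xbar‖ < r → f x - f xbar ≤ (K + 1) * ‖x - xbar‖ := by
    intro x hx
    have hx3 : ‖x - xbar‖ < r₃ := hx.trans_le ((min_le_right _ _).trans (min_le_right _ _))
    have h2 := hK.norm_sub_le (hball (mem_ball_iff_norm.2 hx3)) (mem_of_mem_nhds ht)
    rw [Real.norm_eq_abs] at h2
    linarith [le_abs_self (f x - f xbar), norm_nonneg (x - xbar)]
  have hlow : ∀ x, ‖x - xbar‖ < r → δ / 2 * ‖x - xbar‖ ^ 2 ≤ f x - f xbar := by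
    intro x hx
    exact hgrow x (mem_ball_iff_norm.2
      (hx.trans_le ((min_le_right _ _).trans (min_le_left _ _))))
  -- the sublevel set of `f` at height `f xbar + (K + 1) ρ` lies in the ball of radius `r / 2`
  refine ⟨min (r / 2) (δ * r ^ 2 / (8 * (K + 1))), by positivity, fun x₀ hx₀ => ?_⟩
  obtain ⟨hx₀r, hx₀δ⟩ := lt_min_iff.1 hx₀
  rw [lt_div_iff₀ (by positivity)] at hx₀δ
  set x := fastIterate f L β x₀ with hx
  have hxsucc : ∀ k, x k ≠ xbar → ‖x k - xbar‖ < r →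
      ∃ x', fastStep f L β (x k) = some x' ∧ x (k + 1) = x' := by
    intro k hne hk
    obtain ⟨x', hx', -⟩ := hstep (x k) hne (hk.trans_le (min_le_left _ _))
    refine ⟨x', hx', ?_⟩
    rw [hx, fastIterate, ← hx, hx', Option.getD_some]
  have hprog : ∀ k, ‖x k - xbar‖ < r → f (x (k + 1)) ≤ f (x k) ∧
      ‖x (k + 1) - xbar‖ ≤ 2 * ‖x k - xbar‖ ∧
      (‖x (k + 1) - xbar‖ ≤ q * ‖x k - xbar‖ ∨
        f (x (k + 1)) - f xbar ≤ q * (f (x k) - f xbar)) := by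
    intro k hk
    by_cases hne : x k = xbar
    · have h1 : x (k + 1) = xbar := fastIterate_succ_of_eq hf hzero hL hne
      simp [h1, hne]
    · obtain ⟨x', hx', h1, h2, h3⟩ := hstep (x k) hne (hk.trans_le (min_le_left _ _))
      obtain ⟨x'', hx'', h4⟩ := hxsucc k hne hk
      obtain rfl : x' = x'' := Option.some_injective _ (hx'.symm.trans hx'')
      rw [h4]
      exact ⟨h1, h2, h3⟩
  have hinv : ∀ k, ‖x k - xbar‖ < r / 2 ∧ f (x k) ≤ f x₀ := by
    intro k
    induction k with
    | zero => exact ⟨hx₀r, le_rfl⟩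
    | succ k ih =>
      obtain ⟨h1, h2, -⟩ := hprog k (by linarith [ih.1])
      have h3 : ‖x (k + 1) - xbar‖ < r := by linarith [ih.1]
      have h4 : f (x (k + 1)) ≤ f x₀ := h1.trans ih.2
      refine ⟨lt_of_pow_lt_pow_left₀ 2 (by positivity) ?_, h4⟩
      have h5 := hlow _ h3
      have h6 := hup x₀ (by linarith)
      have h7 : δ / 2 * ‖x (k + 1) - xbar‖ ^ 2 < δ / 2 * (r / 2) ^ 2 := by nlinarith
      exact lt_of_mul_lt_mul_left h7 (by positivity)
  have hin : ∀ k, ‖x k - xbar‖ < r := fun k => by linarith [(hinv k).1]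
  refine ⟨fun k hne => ?_, ?_⟩
  · obtain ⟨x', hx', -⟩ := hxsucc k hne (hin k)
    exact ⟨x', hx'⟩
  · exact exists_le_mul_exp_neg_sqrt (D := fun k => ‖x k - xbar‖)
      (φ := fun k => f (x k) - f xbar) (a := δ / 2) (b := K + 1) (R := r) hq0 hq1 (by positivity)
      (by positivity) (fun k => norm_nonneg _)
      (antitone_nat_of_succ_le fun k => by linarith [(hprog k (hin k)).1])
      (fun k => (hin k).le) (fun k => hlow _ (hin k)) (fun k => hup _ (hin k))
      fun k => (hprog k (hin k)).2.2
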